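/- **Theorem 2.3.** Let $S=(S;\wedge)$ be a finite meet semilattice with $n=|S|>1$ elements, and let $\mathrm{Con}(S)$ be the set of its congruences, that is, of the equivalence relations on $S$ that are compatible with $\wedge$. Terminology. $S$ is a *tree semilattice* if no two incomparable elements of $S$ have an upper bound. The *tree congruence* of $S$ is the least congruence of $S$ containing all pairs $(a\wedge b,\,a\vee b)$ such that $a,b\in S$ are incomparable and their join (least upper bound) $a\vee b$ exists in $S$. $S$ is a *quasi-tree semilattice* if its tree congruence has exactly one nonsingleton block; this block, which is closed under $\wedge$, is then called the *nucleus* of $S$ and is regarded as a meet semilattice, up to isomorphism. $N_5=\{u,a,b,c,v\}$ is the pentagon: $u$ is its least and $v$ its largest element, $a<c$, and $b$ is incomparable with $a$ and $c$. $N_6=\{u,a_1,a_2,a_3,b,v\}$ has least element $u$, largest element $v$, $a_1<a_2<a_3$, and $b$ is incomparable with $a_1,a_2,a_3$. $F=\{u,a,b,c,v_1,v_2\}$ is the six-element meet semilattice with least element $u$ whose only further strict comparabilities are $a<v_1$, $b<v_1$, $b<v_2$, $c<v_2$. Then the following hold. (a) $|\mathrm{Con}(S)|\le 2^{n-1}=32\cdot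 2^{n-6}$, and $|\mathrm{Con}(S)|=2^{n-1}$ if and only if $S$ is a tree semilattice. (b) If $|\mathrm{Con}(S)|<2^{n-1}$, then $|\mathrm{Con}(S)|\le 28\cdot 2^{n-6}$. Furthermore, $|\mathrm{Con}(S)|=28\cdot 2^{n-6}$ if and only if $S$ is a quasi-tree semilattice whose nucleus is the four-element Boolean lattice. (c) If $|\mathrm{Con}(S)|<28\cdot 2^{n-6}$, then $|\mathrm{Con}(S)|\le 26\cdot 2^{n-6}$. Furthermore, $|\mathrm{Con}(S)|=26\cdot 2^{n-6}$ if and only if $S$ is a quasi-tree semilattice whose nucleus is $N_5$. (d) If $|\mathrm{Con}(S)|<26\cdot 2^{n-6}$, then $|\mathrm{Con}(S)|\le 25\cdot 2^{n-6}$. Furthermore, $|\mathrm{Con}(S)|=25\cdot 2^{n-6}$ if and only if $S$ is a quasi-tree semilattice whose nucleus is $F$ or $N_6$. -/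

import Mathlib

namespace FiniteSemilattice

/-- A congruence of a meet semilattice `(S; ∧)`: an equivalence relation compatible with `∧`. -/
@[ext]
structure InfCon (S : Type*) [SemilatticeInf S] extends Setoid S where
  inf : ∀ {w x y z : S}, r w x → r y z → r (w ⊓ y) (x ⊓ z)

/-- A meet semilattice is a tree semilattice if no two incomparable elements of it have
an upper bound. -/
def IsTree (S : Type*) [SemilatticeInf S] : Prop :=
  ∀ a b : S, ¬ a ≤ b → ¬ b ≤ a → ¬ ∃ v : S, a ≤ v ∧ b ≤ v

/-- The tree congruence of `S`: the least congruence that contains all the pairs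
`(a ∧ b, a ∨ b)` such that `a` and `b` are incomparable and their join `a ∨ b`,
the least upper bound of `a` and `b`, exists in `S`. -/
def treeCon (S : Type*) [SemilatticeInf S] : InfCon S where
  r x y := ∀ c : InfCon S,
    (∀ a b v : S, ¬ a ≤ b → ¬ b ≤ a → IsLUB {a, b} v → c.r (a ⊓ b) v) → c.r x y
  iseqv :=
    { refl := fun x c _ => c.iseqv.refl x
      symm := fun h c hc => c.iseqv.symm (h c hc)
      trans := fun h k c hc => c.iseqv.trans (h c hc) (k c hc) }
  inf := fun h k c hc => c.inf (h c hc) (k c hc)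

/-- The nonsingleton blocks of the tree congruence of `S`. -/
def nonsingletonTreeBlocks (S : Type*) [SemilatticeInf S] : Set (Set S) :=
  {B | B ∈ (treeCon S).toSetoid.classes ∧ B.Nontrivial}

/-- `S` is a quasi-tree semilattice if its tree congruence has exactly one nonsingleton block.
(Finiteness of `S` is assumed separately.) -/
def IsQuasiTree (S : Type*) [SemilatticeInf S] : Prop :=
  ∃! B : Set S, B ∈ nonsingletonTreeBlocks S

/-- The nucleus of a quasi-tree semilattice `S`: the unique nonsingleton block of the tree
congruence. (As a total definition it is the union of all the nonsingleton blocks.) -/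
def nucleus (S : Type*) [SemilatticeInf S] : Set S :=
  ⋃₀ nonsingletonTreeBlocks S

theorem nucleus_mem {S : Type*} [SemilatticeInf S] (h : IsQuasiTree S) :
    nucleus S ∈ nonsingletonTreeBlocks S := by
  obtain ⟨B, hB, hu⟩ := h
  have : nonsingletonTreeBlocks S = {B} := Set.eq_singleton_iff_unique_mem.2 ⟨hB, hu⟩
  have hn : nucleus S = B := by rw [nucleus, this, Set.sUnion_singleton]
  rw [hn]
  exact hB

/-- `S` is a quasi-tree semilattice whose nucleus, as a meet semilattice under the operation of
`S`, is isomorphic to `N`: there is a meet-preserving bijection of `N` onto the nucleus. -/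
def IsQuasiTreeWithNucleus (S : Type*) [SemilatticeInf S] (N : Type*) [SemilatticeInf N] : Prop :=
  IsQuasiTree S ∧ ∃ f : InfHom N S, Function.Injective f ∧ Set.range f = nucleus S

/-- The pentagon `N₅`, with bottom `u`, top `v`, `a < c`, and `b` incomparable with
both `a` and `c`. -/
inductive N5 : Type
  | u | a | b | c | v
  deriving DecidableEq

namespace N5

instance : Fintype N5 := ⟨{u, a, b, c, v}, by intro x; cases x <;> decide⟩

instance : LE N5 := ⟨fun x y => x = u ∨ x = y ∨ y = v ∨ (x = a ∧ y = c)⟩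

instance : DecidableRel (fun x y : N5 => x ≤ y) := fun x y =>
  inferInstanceAs (Decidable (x = u ∨ x = y ∨ y = v ∨ (x = a ∧ y = c)))

/-- Two incomparable elements of `N₅` have meet `u`. -/
instance : SemilatticeInf N5 where
  inf x y := if x ≤ y then x else if y ≤ x then y else u
  le_refl := by decide
  le_trans := by decide
  le_antisymm := by decide
  inf_le_left := by decide
  inf_le_right := by decide
  le_inf := by decide

end N5

/-- The six-element lattice `N₆`, with bottom `u`, top `v`, `a₁ < a₂ < a₃`, and `b` incomparable
with each of `a₁`, `a₂`, `a₃`. -/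
inductive N6 : Type
  | u | a₁ | a₂ | a₃ | b | v
  deriving DecidableEq

namespace N6

instance : Fintype N6 := ⟨{u, a₁, a₂, a₃, b, v}, by intro x; cases x <;> decide⟩

instance : LE N6 := ⟨fun x y =>
  x = u ∨ x = y ∨ y = v ∨ (x = a₁ ∧ y = a₂) ∨ (x = a₁ ∧ y = a₃) ∨ (x = a₂ ∧ y = a₃)⟩

instance : DecidableRel (fun x y : N6 => x ≤ y) := fun x y =>
  inferInstanceAs (Decidable
    (x = u ∨ x = y ∨ y = v ∨ (x = a₁ ∧ y = a₂) ∨ (x = a₁ ∧ y = a₃) ∨ (x = a₂ ∧ y = a₃)))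

/-- Two incomparable elements of `N₆` have meet `u`. -/
instance : SemilatticeInf N6 where
  inf x y := if x ≤ y then x else if y ≤ x then y else u
  le_refl := by decide
  le_trans := by decide
  le_antisymm := by decide
  inf_le_left := by decide
  inf_le_right := by decide
  le_inf := by decide

end N6

/-- The six-element meet semilattice `F`, with bottom `u`, three atoms `a`, `b`, `c`, and two
maximal elements `v₁` (above `a` and `b`) and `v₂` (above `b` and `c`). -/
inductive F : Type
  | u | a | b | c | v₁ | v₂
  deriving DecidableEq

namespace F

instance : Fintype F := ⟨{u, a, b, c, v₁, v₂}, by intro x; cases x <;> decide⟩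

instance : LE F := ⟨fun x y =>
  x = u ∨ x = y ∨ (x = a ∧ y = v₁) ∨ (x = b ∧ y = v₁) ∨ (x = b ∧ y = v₂) ∨ (x = c ∧ y = v₂)⟩

instance : DecidableRel (fun x y : F => x ≤ y) := fun x y =>
  inferInstanceAs (Decidable
    (x = u ∨ x = y ∨ (x = a ∧ y = v₁) ∨ (x = b ∧ y = v₁) ∨ (x = b ∧ y = v₂) ∨ (x = c ∧ y = v₂)))

/-- Two incomparable elements of `F` have meet `u`, except that `v₁ ∧ v₂ = b`. -/
instance : SemilatticeInf F where
  inf x y :=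
    if x ≤ y then x else if y ≤ x then y
    else if (x = v₁ ∧ y = v₂) ∨ (x = v₂ ∧ y = v₁) then b else u
  le_refl := by decide
  le_trans := by decide
  le_antisymm := by decide
  inf_le_left := by decide
  inf_le_right := by decide
  le_inf := by decide

end F

end FiniteSemilattice

/-!
# Finite meet semilattices with many congruences

A meet-homomorphism from a finite meet semilattice `S` to the two-element chain is given by a
principal filter or by the empty one. Hence a congruence is determined by its *saturated* elements,
those whose principal filter is a union of blocks, and the sets of saturated elements are exactly
the sets that contain the bottom element and are closed under those binary joins that exist in `S`.
So `2 * |Con S|` is the number of join-closed subsets of `S` (`closedCount_eq_two_mul`).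

Only the *crossing pairs*, the incomparable pairs `{a, b}` with an upper bound, matter: each of them
imposes the clause "if `a` and `b` are in the set, then so is `a ∨ b`". Counting the solutions of a
few clauses on at most six elements bounds the density of the join-closed sets, and any further
crossing pair makes the density strictly smaller (`closedCount_mul_pow`). One clause gives the
density `7 / 8 = 28 / 32`. Two clauses give `26 / 32` if the pairs share an element and have the
same join, `25 / 32` if the pairs share an element and have different joins, and less otherwise,
where two disjoint pairs with the same join force a third pair. Adding a clause to the first of
these cases gives `25 / 32` for three pairs `{aᵢ, b}` with the same join, and otherwise less. This is
`classify_crossings`.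

It remains to read off the tree congruence. In each of the extremal configurations all crossing
pairs have the same meet `u`, and then the only nonsingleton block of the tree congruence consists
of `u`, the members of the crossing pairs, and their joins (`nonsingletonTreeBlocks_eq`); it is
isomorphic to the four-element Boolean lattice, `N₅`, `F` or `N₆`. Conversely, every
crossing pair of a quasi-tree semilattice lies, together with its join, in the nucleus, so the
isomorphism type of the nucleus determines the configuration (`crossing_map_iff`, `isLUB_map`).
-/

namespace FiniteSemilattice

variable {S : Type*} [SemilatticeInf S]

/-! ### Crossing pairs and their joins -/

/-- Two elements cross if they are incomparable and have a common upper bound. -/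
def Crossing (a b : S) : Prop := ¬ a ≤ b ∧ ¬ b ≤ a ∧ ∃ v, a ≤ v ∧ b ≤ v

namespace Crossing

theorem symm {a b : S} (h : Crossing a b) : Crossing b a :=
  ⟨h.2.1, h.1, h.2.2.imp fun _ hv => hv.symm⟩

theorem ne {a b : S} (h : Crossing a b) : a ≠ b := fun e => h.1 e.le

theorem ne_left {a b v : S} (h : Crossing a b) (hv : IsLUB {a, b} v) : v ≠ a := by
  rintro rfl
  exact h.2.1 (hv.1 (by simp))

theorem ne_right {a b v : S} (h : Crossing a b) (hv : IsLUB {a, b} v) : v ≠ b := by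
  rintro rfl
  exact h.1 (hv.1 (by simp))

end Crossing

theorem isLUB_pair_iff {a b v : S} :
    IsLUB {a, b} v ↔ a ≤ v ∧ b ≤ v ∧ ∀ w, a ≤ w → b ≤ w → v ≤ w := by
  constructor
  · intro h
    exact ⟨h.1 (by simp), h.1 (by simp), fun w ha hb => h.2 (by
      rintro x (rfl | rfl) <;> assumption)⟩
  · rintro ⟨ha, hb, h⟩
    refine ⟨by rintro x (rfl | rfl) <;> assumption, fun w hw => h w (hw (by simp)) (hw (by simp))⟩

theorem isLUB_pair_comm {a b v : S} (h : IsLUB {a, b} v) : IsLUB {b, a} v := by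
  rwa [Set.pair_comm]

/-- A set closed under meets in a finite meet semilattice has a least element; here the set
consists of the common upper bounds of `a` and `b`. -/
theorem exists_isLUB_of_le [Finite S] {a b w : S} (ha : a ≤ w) (hb : b ≤ w) :
    ∃ v, IsLUB {a, b} v := by
  obtain ⟨m, ⟨hma, hmb⟩, hmin⟩ :=
    (Set.toFinite {x : S | a ≤ x ∧ b ≤ x}).exists_minimal ⟨w, ha, hb⟩
  refine ⟨m, isLUB_pair_iff.2 ⟨hma, hmb, fun x hxa hxb => ?_⟩⟩
  exact (hmin ⟨le_inf hma hxa, le_inf hmb hxb⟩ inf_le_left).trans inf_le_right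

theorem Crossing.exists_isLUB [Finite S] {a b : S} (h : Crossing a b) : ∃ v, IsLUB {a, b} v :=
  h.2.2.elim fun _ hv => exists_isLUB_of_le hv.1 hv.2

theorem crossing_of_isLUB {a b v : S} (hab : ¬ a ≤ b) (hba : ¬ b ≤ a) (h : IsLUB {a, b} v) :
    Crossing a b :=
  ⟨hab, hba, v, h.1 (by simp), h.1 (by simp)⟩

theorem le_or_le_of_not_crossing {a b v : S} (h : ¬ Crossing a b) (ha : a ≤ v) (hb : b ≤ v) :
    a ≤ b ∨ b ≤ a := by
  by_contra! hn
  exact h ⟨hn.1, hn.2, v, ha, hb⟩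

/-! ### Congruences as join-closed sets -/

/-- A subset of `S`, given by its indicator function, is join-closed if it contains the join of
any two of its elements that cross. (Joins of comparable elements are no condition.) -/
def JoinClosed (X : S → Bool) : Prop :=
  ∀ a b v : S, Crossing a b → IsLUB {a, b} v → X a = true → X b = true → X v = true

/-- The number of join-closed subsets. -/
noncomputable def closedCount (S : Type*) [SemilatticeInf S] : ℕ :=
  Nat.card {X : S → Bool // JoinClosed X}

/-- `a` is saturated for the congruence `c` if its principal filter is a union of blocks. -/
def Saturated (c : InfCon S) (a : S) : Prop := ∀ x y, c.r x y → a ≤ x → a ≤ y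

/-- The congruence that identifies two elements if they lie above the same members of `X`. -/
def conOf (X : S → Bool) : InfCon S where
  r x y := ∀ a, X a = true → (a ≤ x ↔ a ≤ y)
  iseqv :=
    { refl := fun _ _ _ => Iff.rfl
      symm := fun h a ha => (h a ha).symm
      trans := fun h k a ha => (h a ha).trans (k a ha) }
  inf := fun h k a ha => by rw [le_inf_iff, le_inf_iff, h a ha, k a ha]

theorem InfCon.ext_r {c d : InfCon S} (h : ∀ x y, c.r x y ↔ d.r x y) : c = d := by
  rcases c with ⟨⟨r, h1⟩, h2⟩
  rcases d with ⟨⟨r', h1'⟩, h2'⟩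
  have : r = r' := by
    funext x y
    exact propext (h x y)
  subst this
  rfl

theorem exists_least_mem_block [Finite S] (c : InfCon S) (x : S) :
    ∃ m, c.r m x ∧ ∀ y, c.r y x → m ≤ y := by
  obtain ⟨m, hm, hmin⟩ := (Set.toFinite {y : S | c.r y x}).exists_minimal ⟨x, c.iseqv.refl x⟩
  refine ⟨m, hm, fun y hy => ?_⟩
  have : c.r (m ⊓ y) x := by simpa using c.inf hm hy
  exact (hmin this inf_le_left).trans inf_le_right

theorem exists_saturated_mem_block [Finite S] (c : InfCon S) (x : S) :
    ∃ m, c.r m x ∧ Saturated c m := by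
  obtain ⟨m, hm, hmin⟩ := exists_least_mem_block c x
  refine ⟨m, hm, fun y z hyz hy => ?_⟩
  have h : c.r (m ⊓ z) m := by
    have := c.inf (c.iseqv.refl m) (c.iseqv.symm hyz)
    rwa [inf_eq_left.2 hy] at this
  exact (hmin _ (c.iseqv.trans h hm)).trans inf_le_right

/-- A congruence is determined by its saturated elements. -/
theorem rel_iff_forall_saturated [Finite S] (c : InfCon S) (x y : S) :
    c.r x y ↔ ∀ a, Saturated c a → (a ≤ x ↔ a ≤ y) := by
  constructor
  · exact fun h a ha => ⟨ha _ _ h, ha _ _ (c.iseqv.symm h)⟩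
  · intro h
    obtain ⟨m, hm, hms⟩ := exists_saturated_mem_block c x
    obtain ⟨k, hk, hks⟩ := exists_saturated_mem_block c y
    have h1 : m ≤ k := hms _ _ (c.iseqv.symm hk) ((h m hms).1 (hms _ _ hm le_rfl))
    have h2 : k ≤ m := hks _ _ (c.iseqv.symm hm) ((h k hks).2 (hks _ _ hk le_rfl))
    obtain rfl := le_antisymm h1 h2
    exact c.iseqv.trans (c.iseqv.symm hm) hk

theorem Saturated.isLUB {c : InfCon S} {a b v : S} (ha : Saturated c a) (hb : Saturated c b)
    (hv : IsLUB {a, b} v) : Saturated c v := by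
  obtain ⟨hav, hbv, hmin⟩ := isLUB_pair_iff.1 hv
  exact fun x y hxy hx => hmin y (ha x y hxy (hav.trans hx)) (hb x y hxy (hbv.trans hx))

/-- Apart from the bottom element, the saturated elements of `conOf X` are the members of `X`:
if `p` is saturated, it coincides with the greatest member of `X ∪ {⊥}` below it. -/
theorem saturated_conOf_iff [Finite S] {X : S → Bool} (hX : JoinClosed X) {o p : S}
    (ho : ∀ x, o ≤ x) (hp : p ≠ o) : Saturated (conOf X) p ↔ X p = true := by
  constructor
  · intro h
    obtain ⟨y, ⟨hy, hyp⟩, hmax⟩ :=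
      (Set.toFinite {a : S | (X a = true ∨ a = o) ∧ a ≤ p}).exists_maximal ⟨o, .inr rfl, ho p⟩
    have hr : (conOf X).r p y := by
      intro a ha
      refine ⟨fun hap => ?_, fun hay => hay.trans hyp⟩
      by_contra hay
      have hya : ¬ y ≤ a := fun hya => hay (hmax ⟨.inl ha, hap⟩ hya)
      have hyX : X y = true := by
        rcases hy with hy | rfl
        · exact hy
        · exact absurd (ho a) hya
      have hc : Crossing a y := ⟨hay, hya, p, hap, hyp⟩
      obtain ⟨v, hv⟩ := hc.exists_isLUB
      obtain ⟨hav, hyv, hmin⟩ := isLUB_pair_iff.1 hv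
      exact hay (hav.trans (hmax ⟨.inl (hX a y v hc hv ha hyX), hmin p hap hyp⟩ hyv))
    obtain rfl : p = y := le_antisymm (h p y hr le_rfl) hyp
    exact hy.resolve_right hp
  · exact fun h x y hxy hx => (hxy p h).1 hx

open Classical in
/-- Join-closed sets correspond to congruences together with the choice whether the bottom
element `o`, which is irrelevant both for `JoinClosed` and for `conOf`, belongs to the set. -/
noncomputable def joinClosedEquiv [Finite S] (o : S) (ho : ∀ x : S, o ≤ x) :
    {X : S → Bool // JoinClosed X} ≃ InfCon S × Bool where
  toFun X := (conOf X.1, X.1 o)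
  invFun q := ⟨fun a => if a = o then q.2 else decide (Saturated q.1 a), by
    intro a b v hab hv ha hb
    have ha' : a ≠ o := fun e => hab.1 (e ▸ ho b)
    have hb' : b ≠ o := fun e => hab.2.1 (e ▸ ho a)
    have hv' : v ≠ o := by
      rintro rfl
      exact ha' (le_antisymm (hv.1 (by simp)) (ho a))
    beta_reduce at ha hb ⊢
    rw [if_neg ha', decide_eq_true_iff] at ha
    rw [if_neg hb', decide_eq_true_iff] at hb
    rw [if_neg hv', decide_eq_true_iff]
    exact ha.isLUB hb hv⟩
  left_inv X := by
    ext a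
    by_cases ha : a = o
    · simp [ha]
    · have := saturated_conOf_iff X.2 ho ha
      simp only [if_neg ha, this]
      simp
  right_inv q := by
    refine Prod.ext (InfCon.ext_r fun x y => ?_) (by simp)
    rw [rel_iff_forall_saturated q.1]
    refine forall_congr' fun a => ?_
    by_cases ha : a = o
    · simp [ha, ho]
    · simp [ha]

theorem closedCount_eq_two_mul [Finite S] [Nonempty S] :
    closedCount S = 2 * Nat.card (InfCon S) := by
  obtain ⟨o, -, hmin⟩ := (Set.toFinite (Set.univ : Set S)).exists_minimal Set.univ_nonempty
  have ho : ∀ x : S, o ≤ x := fun x => (hmin (Set.mem_univ (o ⊓ x)) inf_le_left).trans inf_le_right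
  rw [closedCount, Nat.card_congr (joinClosedEquiv o ho), Nat.card_prod, mul_comm]
  simp

/-! ### Counting join-closed sets through a configuration of clauses -/

/-- The number of subsets of `Fin k` that satisfy every clause `(i, j, l)` of the list `L`,
read as: if `i` and `j` belong to the set, then so does `l`. -/
def clauseCount (k : ℕ) (L : List (Fin k × Fin k × Fin k)) : ℕ :=
  Fintype.card {p : Fin k → Bool // ∀ t ∈ L, p t.1 = true → p t.2.1 = true → p t.2.2 = true}

theorem card_restrict {ι S : Type*} [Finite S] {g : ι → S} (hg : Function.Injective g)
    (P : (ι → Bool) → Prop) :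
    Nat.card {X : S → Bool // P (X ∘ g)} * 2 ^ Nat.card ι =
      Nat.card {p : ι → Bool // P p} * 2 ^ Nat.card S := by
  classical
  have : Finite ι := Finite.of_injective g hg
  let e : ι ⊕ ((Set.range g)ᶜ : Set S) ≃ S :=
    ((Equiv.ofInjective g hg).sumCongr (Equiv.refl _)).trans (Equiv.Set.sumCompl _)
  have he : ∀ i, e (Sum.inl i) = g i := fun i => by simp [e]
  let E : (S → Bool) ≃ (ι → Bool) × (((Set.range g)ᶜ : Set S) → Bool) :=
    (e.symm.arrowCongr (Equiv.refl _)).trans (Equiv.sumArrowEquivProdArrow _ _ _)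
  have hE : ∀ X, (E X).1 = X ∘ g := fun X => by
    funext i
    simp [E, he]
  have e1 : {X : S → Bool // P (X ∘ g)} ≃
      {p : ι → Bool // P p} × (((Set.range g)ᶜ : Set S) → Bool) :=
    (E.subtypeEquiv (q := fun q => P q.1) fun X => by rw [hE]).trans
      (Equiv.prodSubtypeFstEquivSubtypeProd (p := P))
  have hc : Nat.card ι + Nat.card ((Set.range g)ᶜ : Set S) = Nat.card S := by
    rw [← Nat.card_sum, Nat.card_congr e]
  rw [Nat.card_congr e1, Nat.card_prod, Nat.card_fun, ← hc, pow_add]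
  simp only [Nat.card_eq_fintype_card, Fintype.card_bool]
  ring

/-- If `g` places the clauses of `L` at crossing pairs of `S` and their joins, then the density of
the join-closed sets is at most that of the solutions of `L`. It is the same if there are no
further crossing pairs, and smaller otherwise: for a further crossing pair `{x, y}`, the set
`{x, y}` satisfies `L` without being join-closed. -/
theorem closedCount_mul_pow [Finite S] {k : ℕ} {g : Fin k → S} (hg : Function.Injective g)
    {L : List (Fin k × Fin k × Fin k)}
    (hL : ∀ t ∈ L, Crossing (g t.1) (g t.2.1) ∧ IsLUB {g t.1, g t.2.1} (g t.2.2)) :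
    closedCount S * 2 ^ k ≤ clauseCount k L * 2 ^ Nat.card S ∧
    ((∀ x y : S, Crossing x y → ∃ t ∈ L, s(x, y) = s(g t.1, g t.2.1)) →
      closedCount S * 2 ^ k = clauseCount k L * 2 ^ Nat.card S) ∧
    (∀ x y : S, Crossing x y → (∀ t ∈ L, s(x, y) ≠ s(g t.1, g t.2.1)) →
      closedCount S * 2 ^ k < clauseCount k L * 2 ^ Nat.card S) := by
  classical
  let P : (Fin k → Bool) → Prop :=
    fun p => ∀ t ∈ L, p t.1 = true → p t.2.1 = true → p t.2.2 = true
  have hcard := card_restrict hg P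
  have hP : Nat.card {p // P p} = clauseCount k L := by
    rw [clauseCount, Nat.card_eq_fintype_card]
  rw [hP, Nat.card_fin] at hcard
  have hsub : {X : S → Bool | JoinClosed X} ⊆ {X | P (X ∘ g)} :=
    fun X hX t ht h1 h2 => hX _ _ _ (hL t ht).1 (hL t ht).2 h1 h2
  have hfin : {X : S → Bool | P (X ∘ g)}.Finite := Set.toFinite _
  rw [← hcard]
  refine ⟨Nat.mul_le_mul_right _ (Nat.card_mono hfin hsub), fun hall => ?_, fun x y hxy hne => ?_⟩
  · have : {X : S → Bool | JoinClosed X} = {X | P (X ∘ g)} := by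
      refine hsub.antisymm fun X hX x y v hxy hv hx hy => ?_
      obtain ⟨t, ht, hs⟩ := hall x y hxy
      have hlub := (hL t ht).2
      rcases Sym2.eq_iff.1 hs with ⟨rfl, rfl⟩ | ⟨rfl, rfl⟩
      · rw [hv.unique hlub]
        exact hX t ht hx hy
      · rw [(isLUB_pair_comm hv).unique hlub]
        exact hX t ht hy hx
    congr 1
    exact congrArg (fun A : Set (S → Bool) => Nat.card A) this
  · refine Nat.mul_lt_mul_of_pos_right ?_ (by positivity)
    refine Set.ncard_lt_ncard (hsub.ssubset_of_mem_notMem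
      (a := fun z => decide (z = x ∨ z = y)) ?_ ?_) hfin
    · intro t ht h1 h2
      simp only [Function.comp, decide_eq_true_iff] at h1 h2
      have hn := (hL t ht).1.ne
      exfalso
      apply hne t ht
      rw [eq_comm, Sym2.eq_iff]
      rcases h1 with h1 | h1 <;> rcases h2 with h2 | h2 <;> simp_all
    · intro h
      obtain ⟨v, hv⟩ := hxy.exists_isLUB
      have := h x y v hxy hv (by simp) (by simp)
      simp only [decide_eq_true_iff] at this
      exact this.elim (hxy.ne_left hv) (hxy.ne_right hv)

theorem clauseCount_one : clauseCount 3 [(0, 1, 2)] = 7 := by decide +kernel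

theorem clauseCount_two_common_join : clauseCount 4 [(0, 2, 3), (1, 2, 3)] = 13 := by
  decide +kernel

theorem clauseCount_two_shared : clauseCount 5 [(0, 1, 3), (2, 1, 4)] = 25 := by decide +kernel

theorem clauseCount_two_disjoint : clauseCount 6 [(0, 1, 2), (3, 4, 5)] = 49 := by decide +kernel

theorem clauseCount_two_disjoint_common_join :
    clauseCount 5 [(0, 1, 4), (2, 3, 4)] = 25 := by decide +kernel

theorem clauseCount_two_consecutive : clauseCount 5 [(0, 1, 2), (2, 3, 4)] = 24 := by
  decide +kernel

theorem clauseCount_triangle : clauseCount 4 [(0, 1, 3), (1, 2, 3), (0, 2, 3)] = 12 := by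
  decide +kernel

theorem clauseCount_star : clauseCount 5 [(0, 3, 4), (1, 3, 4), (2, 3, 4)] = 25 := by
  decide +kernel

/-! ### The extremal configurations of crossing pairs -/

/-- There is exactly one crossing pair. -/
def HasOneCrossing (S : Type*) [SemilatticeInf S] : Prop :=
  ∃ a b v : S, Crossing a b ∧ IsLUB {a, b} v ∧ ∀ x y : S, Crossing x y → s(x, y) = s(a, b)

/-- There are exactly two crossing pairs; they share an element, have the same join, and the
other two elements form a chain. -/
def HasPentagonCrossings (S : Type*) [SemilatticeInf S] : Prop :=
  ∃ a b c v : S, a < c ∧ Crossing a b ∧ Crossing c b ∧ IsLUB {a, b} v ∧ IsLUB {c, b} v ∧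
    ∀ x y : S, Crossing x y → s(x, y) = s(a, b) ∨ s(x, y) = s(c, b)

/-- There are exactly two crossing pairs; they share an element and have different joins. -/
def HasForkCrossings (S : Type*) [SemilatticeInf S] : Prop :=
  ∃ a b c v w : S, v ≠ w ∧ Crossing a b ∧ Crossing c b ∧ IsLUB {a, b} v ∧ IsLUB {c, b} w ∧
    ∀ x y : S, Crossing x y → s(x, y) = s(a, b) ∨ s(x, y) = s(c, b)

/-- There are exactly three crossing pairs; they share an element, have the same join, and the
other three elements form a chain. -/
def HasHexagonCrossings (S : Type*) [SemilatticeInf S] : Prop :=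
  ∃ a₁ a₂ a₃ b v : S, a₁ < a₂ ∧ a₂ < a₃ ∧ Crossing a₁ b ∧ Crossing a₂ b ∧ Crossing a₃ b ∧
    IsLUB {a₁, b} v ∧ IsLUB {a₂, b} v ∧ IsLUB {a₃, b} v ∧
    ∀ x y : S, Crossing x y → s(x, y) = s(a₁, b) ∨ s(x, y) = s(a₂, b) ∨ s(x, y) = s(a₃, b)

/-! ### Counts for the configurations -/

theorem closedCount_of_no_crossing [Finite S] (h : ∀ x y : S, ¬ Crossing x y) :
    closedCount S = 2 ^ Nat.card S := by
  have : ∀ X : S → Bool, JoinClosed X := fun X a b v hab => absurd hab (h a b)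
  rw [closedCount, Nat.card_congr (Equiv.subtypeUnivEquiv this), Nat.card_fun]
  simp

theorem closedCount_one [Finite S] {a b v : S} (hab : Crossing a b) (hv : IsLUB {a, b} v)
    (hall : ∀ x y : S, Crossing x y → s(x, y) = s(a, b)) :
    closedCount S * 8 = 7 * 2 ^ Nat.card S := by
  have h1 := hab.ne
  have h2 := hab.ne_left hv
  have h3 := hab.ne_right hv
  have hg : Function.Injective ![a, b, v] := by
    intro i j h
    fin_cases i <;> fin_cases j <;> simp_all
  rw [← clauseCount_one]
  exact (closedCount_mul_pow hg (L := [(0, 1, 2)]) (by simp [hab, hv])).2.1 (by simpa using hall)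

theorem closedCount_two_common_join [Finite S] {a b c v : S} (hac : a ≠ c) (hab : Crossing a b)
    (hcb : Crossing c b) (hv : IsLUB {a, b} v) (hv' : IsLUB {c, b} v)
    (hall : ∀ x y : S, Crossing x y → s(x, y) = s(a, b) ∨ s(x, y) = s(c, b)) :
    closedCount S * 16 = 13 * 2 ^ Nat.card S := by
  have h1 := hab.ne
  have h2 := hab.ne_left hv
  have h3 := hab.ne_right hv
  have h4 := hcb.ne
  have h5 := hcb.ne_left hv'
  have hg : Function.Injective ![a, c, b, v] := by
    intro i j h
    fin_cases i <;> fin_cases j <;> simp_all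
  rw [← clauseCount_two_common_join]
  exact (closedCount_mul_pow hg (L := [(0, 2, 3), (1, 2, 3)])
    (by simp [hab, hv, hcb, hv'])).2.1 (by simpa using hall)

theorem closedCount_two_shared [Finite S] {a b c v w : S} (hvw : v ≠ w) (hab : Crossing a b)
    (hcb : Crossing c b) (hv : IsLUB {a, b} v) (hw : IsLUB {c, b} w) :
    ((∀ x y : S, Crossing x y → s(x, y) = s(a, b) ∨ s(x, y) = s(c, b)) →
      closedCount S * 32 = 25 * 2 ^ Nat.card S) ∧
    (¬ (∀ x y : S, Crossing x y → s(x, y) = s(a, b) ∨ s(x, y) = s(c, b)) →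
      closedCount S * 32 < 25 * 2 ^ Nat.card S) := by
  have h1 := hab.ne
  have h2 := hab.ne_left hv
  have h3 := hab.ne_right hv
  have h4 := hcb.ne
  have h5 := hcb.ne_left hw
  have h6 := hcb.ne_right hw
  have h7 : a ≠ c := by
    rintro rfl
    exact hvw (hv.unique hw)
  have h8 : v ≠ c := by
    rintro rfl
    exact hcb.2.1 (hv.1 (by simp))
  have h9 : w ≠ a := by
    rintro rfl
    exact hab.2.1 (hw.1 (by simp))
  have hg : Function.Injective ![a, b, c, v, w] := by
    intro i j h
    fin_cases i <;> fin_cases j <;> simp_all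
  have := closedCount_mul_pow hg (L := [(0, 1, 3), (2, 1, 4)]) (by simp [hab, hv, hcb, hw])
  rw [clauseCount_two_shared] at this
  refine ⟨fun h => this.2.1 (by simpa using h), fun h => ?_⟩
  push Not at h
  obtain ⟨x, y, hxy, h⟩ := h
  exact this.2.2 x y hxy (by simpa using h)

theorem closedCount_star [Finite S] {a₁ a₂ a₃ b v : S} (h12 : a₁ ≠ a₂) (h13 : a₁ ≠ a₃)
    (h23 : a₂ ≠ a₃) (h1 : Crossing a₁ b) (h2 : Crossing a₂ b) (h3 : Crossing a₃ b)
    (hv1 : IsLUB {a₁, b} v) (hv2 : IsLUB {a₂, b} v) (hv3 : IsLUB {a₃, b} v) :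
    ((∀ x y : S, Crossing x y → s(x, y) = s(a₁, b) ∨ s(x, y) = s(a₂, b) ∨ s(x, y) = s(a₃, b)) →
      closedCount S * 32 = 25 * 2 ^ Nat.card S) ∧
    (¬ (∀ x y : S, Crossing x y →
        s(x, y) = s(a₁, b) ∨ s(x, y) = s(a₂, b) ∨ s(x, y) = s(a₃, b)) →
      closedCount S * 32 < 25 * 2 ^ Nat.card S) := by
  have e1 := h1.ne
  have e2 := h2.ne
  have e3 := h3.ne
  have f1 := h1.ne_left hv1
  have f2 := h2.ne_left hv2
  have f3 := h3.ne_left hv3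
  have f4 := h3.ne_right hv3
  have hg : Function.Injective ![a₁, a₂, a₃, b, v] := by
    intro i j h
    fin_cases i <;> fin_cases j <;> simp_all
  have := closedCount_mul_pow hg (L := [(0, 3, 4), (1, 3, 4), (2, 3, 4)])
    (by simp [h1, h2, h3, hv1, hv2, hv3])
  rw [clauseCount_star] at this
  refine ⟨fun h => this.2.1 (by simpa using h), fun h => ?_⟩
  push Not at h
  obtain ⟨x, y, hxy, h⟩ := h
  exact this.2.2 x y hxy (by simpa using h)

theorem closedCount_triangle [Finite S] {a b c v : S} (hab : Crossing a b) (hbc : Crossing b c)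
    (hac : Crossing a c) (h1 : IsLUB {a, b} v) (h2 : IsLUB {b, c} v) (h3 : IsLUB {a, c} v) :
    closedCount S * 32 < 25 * 2 ^ Nat.card S := by
  have e1 := hab.ne
  have e2 := hbc.ne
  have e3 := hac.ne
  have f1 := hab.ne_left h1
  have f2 := hab.ne_right h1
  have f3 := hac.ne_right h3
  have hg : Function.Injective ![a, b, c, v] := by
    intro i j h
    fin_cases i <;> fin_cases j <;> simp_all
  have := (closedCount_mul_pow hg (L := [(0, 1, 3), (1, 2, 3), (0, 2, 3)])
    (by simp [hab, hbc, hac, h1, h2, h3])).1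
  rw [clauseCount_triangle] at this
  have : 0 < 2 ^ Nat.card S := by positivity
  lia

theorem closedCount_consecutive [Finite S] {a b c d w : S} (hab : Crossing a b)
    (hv : IsLUB {a, b} c) (hcd : Crossing c d) (hw : IsLUB {c, d} w) (had : a ≠ d) (hbd : b ≠ d) :
    closedCount S * 32 < 25 * 2 ^ Nat.card S := by
  have hac : a ≤ c := hv.1 (by simp)
  have hbc : b ≤ c := hv.1 (by simp)
  have hcw : c ≤ w := hw.1 (by simp)
  have e1 := hab.ne
  have e2 := hab.ne_left hv
  have e3 := hab.ne_right hv
  have e4 := hcd.ne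
  have e5 := hcd.ne_left hw
  have e6 := hcd.ne_right hw
  have e7 : w ≠ a := by
    rintro rfl
    exact e2 (le_antisymm hcw hac)
  have e8 : w ≠ b := by
    rintro rfl
    exact e3 (le_antisymm hcw hbc)
  have hg : Function.Injective ![a, b, c, d, w] := by
    intro i j h
    fin_cases i <;> fin_cases j <;> simp_all
  have := (closedCount_mul_pow hg (L := [(0, 1, 2), (2, 3, 4)])
    (by simp [hab, hv, hcd, hw])).1
  rw [clauseCount_two_consecutive] at this
  have : 0 < 2 ^ Nat.card S := by positivity
  lia

/-- Two disjoint crossing pairs with a common join force a third crossing pair: otherwise the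
four elements would form a chain. -/
theorem closedCount_disjoint_common_join [Finite S] {a b c d v : S} (hab : Crossing a b)
    (hcd : Crossing c d) (hac : a ≠ c) (had : a ≠ d) (hbc : b ≠ c) (hbd : b ≠ d)
    (hv : IsLUB {a, b} v) (hw : IsLUB {c, d} v) :
    closedCount S * 32 < 25 * 2 ^ Nat.card S := by
  have e1 := hab.ne
  have e2 := hab.ne_left hv
  have e3 := hab.ne_right hv
  have e4 := hcd.ne
  have e5 := hcd.ne_left hw
  have e6 := hcd.ne_right hw
  have hg : Function.Injective ![a, b, c, d, v] := by
    intro i j h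
    fin_cases i <;> fin_cases j <;> simp_all
  have := (closedCount_mul_pow hg (L := [(0, 1, 4), (2, 3, 4)]) (by simp [hab, hv, hcd, hw])).2.2
  rw [clauseCount_two_disjoint_common_join] at this
  obtain ⟨x, y, hxy, hne⟩ : ∃ x y : S, Crossing x y ∧ s(x, y) ≠ s(a, b) ∧ s(x, y) ≠ s(c, d) := by
    by_contra! hn
    obtain ⟨hav, hbv, hv'⟩ := isLUB_pair_iff.1 hv
    obtain ⟨hcv, hdv, hw'⟩ := isLUB_pair_iff.1 hw
    have key : ∀ {x y : S}, x ≤ v → y ≤ v → (x = a ∨ x = b) → (y = c ∨ y = d) → x ≤ y ∨ y ≤ x := by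
      intro x y hx hy hxx hyy
      refine le_or_le_of_not_crossing (fun hc => ?_) hx hy
      have h1 : s(x, y) ≠ s(a, b) := by
        rw [Ne, Sym2.eq_iff]
        rcases hyy with rfl | rfl <;> tauto
      have h2 := hn x y hc h1
      rw [Sym2.eq_iff] at h2
      rcases hxx with rfl | rfl <;> tauto
    have k1 := key hav hcv (.inl rfl) (.inl rfl)
    have k2 := key hav hdv (.inl rfl) (.inr rfl)
    have k3 := key hbv hcv (.inr rfl) (.inl rfl)
    have k4 := key hbv hdv (.inr rfl) (.inr rfl)
    have n1 : ¬ (a ≤ c ∧ b ≤ c) := fun h => e5 (le_antisymm (hv' _ h.1 h.2) hcv)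
    have n2 : ¬ (a ≤ d ∧ b ≤ d) := fun h => e6 (le_antisymm (hv' _ h.1 h.2) hdv)
    have n3 : ¬ (c ≤ a ∧ d ≤ a) := fun h => e2 (le_antisymm (hw' _ h.1 h.2) hav)
    have hca : c ≤ a := k1.resolve_left fun h =>
      k3.elim (fun h' => n1 ⟨h, h'⟩) fun h' => hab.1 (h.trans h')
    have hda : d ≤ a := k2.resolve_left fun h =>
      k4.elim (fun h' => n2 ⟨h, h'⟩) fun h' => hab.1 (h.trans h')
    exact n3 ⟨hca, hda⟩
  exact this x y hxy (by simpa using hne)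

theorem closedCount_disjoint [Finite S] {a b c d : S} (hab : Crossing a b)
    (hcd : Crossing c d) (hac : a ≠ c) (had : a ≠ d) (hbc : b ≠ c) (hbd : b ≠ d) :
    closedCount S * 32 < 25 * 2 ^ Nat.card S := by
  obtain ⟨v, hv⟩ := hab.exists_isLUB
  obtain ⟨w, hw⟩ := hcd.exists_isLUB
  by_cases hvw : v = w
  · subst hvw
    exact closedCount_disjoint_common_join hab hcd hac had hbc hbd hv hw
  by_cases hvc : v = c
  · subst hvc
    exact closedCount_consecutive hab hv hcd hw had hbd
  by_cases hvd : v = d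
  · subst hvd
    exact closedCount_consecutive hab hv hcd.symm (isLUB_pair_comm hw) hac hbc
  by_cases hwa : w = a
  · subst hwa
    exact closedCount_consecutive hcd hw hab hv hbc.symm hbd.symm
  by_cases hwb : w = b
  · subst hwb
    exact closedCount_consecutive hcd hw hab.symm (isLUB_pair_comm hv) hac.symm had.symm
  have e1 := hab.ne
  have e2 := hab.ne_left hv
  have e3 := hab.ne_right hv
  have e4 := hcd.ne
  have e5 := hcd.ne_left hw
  have e6 := hcd.ne_right hw
  have hg : Function.Injective ![a, b, v, c, d, w] := by
    intro i j h
    fin_cases i <;> fin_cases j <;> simp_all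
  have := (closedCount_mul_pow hg (L := [(0, 1, 2), (3, 4, 5)]) (by simp [hab, hv, hcd, hw])).1
  rw [clauseCount_two_disjoint] at this
  have : 0 < 2 ^ Nat.card S := by positivity
  lia

theorem HasOneCrossing.closedCount [Finite S] (h : HasOneCrossing S) :
    closedCount S * 32 = 28 * 2 ^ Nat.card S := by
  obtain ⟨a, b, v, hab, hv, hall⟩ := h
  have := closedCount_one hab hv hall
  lia

theorem HasPentagonCrossings.closedCount [Finite S] (h : HasPentagonCrossings S) :
    closedCount S * 32 = 26 * 2 ^ Nat.card S := by
  obtain ⟨a, b, c, v, hac, hab, hcb, hv, hv', hall⟩ := h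
  have := closedCount_two_common_join hac.ne hab hcb hv hv' hall
  lia

theorem HasForkCrossings.closedCount [Finite S] (h : HasForkCrossings S) :
    closedCount S * 32 = 25 * 2 ^ Nat.card S := by
  obtain ⟨a, b, c, v, w, hvw, hab, hcb, hv, hw, hall⟩ := h
  exact (closedCount_two_shared hvw hab hcb hv hw).1 hall

theorem HasHexagonCrossings.closedCount [Finite S] (h : HasHexagonCrossings S) :
    closedCount S * 32 = 25 * 2 ^ Nat.card S := by
  obtain ⟨a₁, a₂, a₃, b, v, h12, h23, h1, h2, h3, hv1, hv2, hv3, hall⟩ := h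
  exact (closedCount_star h12.ne (h12.trans h23).ne h23.ne h1 h2 h3 hv1 hv2 hv3).1 hall

/-! ### Classification by density -/

theorem fork_or_lt [Finite S] {a b c v w : S} (hvw : v ≠ w) (hab : Crossing a b)
    (hcb : Crossing c b) (hv : IsLUB {a, b} v) (hw : IsLUB {c, b} w) :
    HasForkCrossings S ∨ closedCount S * 32 < 25 * 2 ^ Nat.card S := by
  by_cases h : ∀ x y : S, Crossing x y → s(x, y) = s(a, b) ∨ s(x, y) = s(c, b)
  · exact .inl ⟨a, b, c, v, w, hvw, hab, hcb, hv, hw, h⟩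
  · exact .inr ((closedCount_two_shared hvw hab hcb hv hw).2 h)

theorem star_or_lt [Finite S] {a₁ a₂ a₃ b v : S} (h12 : a₁ ≠ a₂) (h13 : a₁ ≠ a₃)
    (h23 : a₂ ≠ a₃) (h1 : Crossing a₁ b) (h2 : Crossing a₂ b) (h3 : Crossing a₃ b)
    (hv1 : IsLUB {a₁, b} v) (hv2 : IsLUB {a₂, b} v) (hv3 : IsLUB {a₃, b} v) :
    HasHexagonCrossings S ∨ closedCount S * 32 < 25 * 2 ^ Nat.card S := by
  by_cases h : ∀ x y : S, Crossing x y →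
      s(x, y) = s(a₁, b) ∨ s(x, y) = s(a₂, b) ∨ s(x, y) = s(a₃, b)
  · left
    have hlt : ∀ {x y : S}, x ≠ b → y ≠ b → x ≤ v → y ≤ v → x ≠ y → x < y ∨ y < x := by
      intro x y hx hy hxv hyv hxy
      have hc : ¬ Crossing x y := by
        intro hc
        have := h x y hc
        simp only [Sym2.eq_iff] at this
        tauto
      rcases le_or_le_of_not_crossing hc hxv hyv with h | h
      · exact .inl (lt_of_le_of_ne h hxy)
      · exact .inr (lt_of_le_of_ne h hxy.symm)
    have l1 : a₁ ≤ v := hv1.1 (by simp)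
    have l2 : a₂ ≤ v := hv2.1 (by simp)
    have l3 : a₃ ≤ v := hv3.1 (by simp)
    have o12 := hlt h1.ne h2.ne l1 l2 h12
    have o13 := hlt h1.ne h3.ne l1 l3 h13
    have o23 := hlt h2.ne h3.ne l2 l3 h23
    rcases o12 with o12 | o12
    · rcases o23 with o23 | o23
      · exact ⟨a₁, a₂, a₃, b, v, o12, o23, h1, h2, h3, hv1, hv2, hv3, h⟩
      · rcases o13 with o13 | o13
        · exact ⟨a₁, a₃, a₂, b, v, o13, o23, h1, h3, h2, hv1, hv3, hv2,
            fun x y hxy => by have := h x y hxy; tauto⟩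
        · exact ⟨a₃, a₁, a₂, b, v, o13, o12, h3, h1, h2, hv3, hv1, hv2,
            fun x y hxy => by have := h x y hxy; tauto⟩
    · rcases o13 with o13 | o13
      · exact ⟨a₂, a₁, a₃, b, v, o12, o13, h2, h1, h3, hv2, hv1, hv3,
            fun x y hxy => by have := h x y hxy; tauto⟩
      · rcases o23 with o23 | o23
        · exact ⟨a₂, a₃, a₁, b, v, o23, o13, h2, h3, h1, hv2, hv3, hv1,
            fun x y hxy => by have := h x y hxy; tauto⟩
        · exact ⟨a₃, a₂, a₁, b, v, o23, o12, h3, h2, h1, hv3, hv2, hv1,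
            fun x y hxy => by have := h x y hxy; tauto⟩
  · exact .inr ((closedCount_star h12 h13 h23 h1 h2 h3 hv1 hv2 hv3).2 h)

/-- The case of two crossing pairs that share an element and have the same join. A third crossing
pair either contains the shared element, or is disjoint from one of the two, or completes a
triangle. -/
theorem classify_common_join [Finite S] {a b c v : S} (hac : a ≠ c) (hab : Crossing a b)
    (hcb : Crossing c b) (hv : IsLUB {a, b} v) (hv' : IsLUB {c, b} v) :
    HasPentagonCrossings S ∨ HasForkCrossings S ∨ HasHexagonCrossings S ∨
      closedCount S * 32 < 25 * 2 ^ Nat.card S := by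
  by_cases h : ∀ x y : S, Crossing x y → s(x, y) = s(a, b) ∨ s(x, y) = s(c, b)
  · left
    have hc : ¬ Crossing a c := by
      intro hc
      have := h a c hc
      simp only [Sym2.eq_iff] at this
      have := hab.ne
      have := hcb.ne
      tauto
    rcases le_or_le_of_not_crossing hc (hv.1 (by simp)) (hv'.1 (by simp)) with h1 | h1
    · exact ⟨a, b, c, v, lt_of_le_of_ne h1 hac, hab, hcb, hv, hv', h⟩
    · exact ⟨c, b, a, v, lt_of_le_of_ne h1 hac.symm, hcb, hab, hv', hv,
        fun x y hxy => (h x y hxy).symm⟩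
  · right
    push Not at h
    obtain ⟨p, q, hpq, hn1, hn2⟩ := h
    have star : ∀ p, Crossing p b → p ≠ a → p ≠ c → HasForkCrossings S ∨ HasHexagonCrossings S ∨
        closedCount S * 32 < 25 * 2 ^ Nat.card S := by
      intro p hp hpa hpc
      obtain ⟨w, hw⟩ := hp.exists_isLUB
      by_cases hvw : v = w
      · subst hvw
        exact .inr (star_or_lt hac hpa.symm hpc.symm hab hcb hp hv hv' hw)
      · exact (fork_or_lt hvw hab hp hv hw).imp_right .inr
    have tri : Crossing a c → HasForkCrossings S ∨ HasHexagonCrossings S ∨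
        closedCount S * 32 < 25 * 2 ^ Nat.card S := by
      intro hc
      obtain ⟨w, hw⟩ := hc.exists_isLUB
      by_cases hvw : v = w
      · subst hvw
        exact .inr (.inr (closedCount_triangle hab hcb.symm hc hv (isLUB_pair_comm hv') hw))
      · exact (fork_or_lt hvw hab.symm hc.symm (isLUB_pair_comm hv)
          (isLUB_pair_comm hw)).imp_right .inr
    simp only [Ne, Sym2.eq_iff, not_or, not_and] at hn1 hn2
    by_cases hqb : q = b
    · subst hqb
      exact star p hpq (fun e => hn1.1 e rfl) (fun e => hn2.1 e rfl)
    by_cases hpb : p = b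
    · subst hpb
      exact star q hpq.symm (hn1.2 rfl) (hn2.2 rfl)
    by_cases h1 : a ≠ p ∧ a ≠ q
    · exact .inr (.inr (closedCount_disjoint hab hpq h1.1 h1.2 (Ne.symm hpb) (Ne.symm hqb)))
    by_cases h2 : c ≠ p ∧ c ≠ q
    · exact .inr (.inr (closedCount_disjoint hcb hpq h2.1 h2.2 (Ne.symm hpb) (Ne.symm hqb)))
    have : (a = p ∧ c = q) ∨ (a = q ∧ c = p) := by
      by_cases a = p <;> by_cases c = p <;> simp_all
    rcases this with ⟨rfl, rfl⟩ | ⟨rfl, rfl⟩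
    · exact tri hpq
    · exact tri hpq.symm

theorem classify_shared [Finite S] {a b c : S} (hac : a ≠ c) (hab : Crossing a b)
    (hcb : Crossing c b) :
    HasPentagonCrossings S ∨ HasForkCrossings S ∨ HasHexagonCrossings S ∨
      closedCount S * 32 < 25 * 2 ^ Nat.card S := by
  obtain ⟨v, hv⟩ := hab.exists_isLUB
  obtain ⟨w, hw⟩ := hcb.exists_isLUB
  by_cases hvw : v = w
  · subst hvw
    exact classify_common_join hac hab hcb hv hw
  · rcases fork_or_lt hvw hab hcb hv hw with h | h <;> tauto

/-- The configurations of crossing pairs for which the join-closed sets have density at least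
`25 / 32`. -/
theorem classify_crossings (S : Type*) [SemilatticeInf S] [Finite S] :
    (∀ x y : S, ¬ Crossing x y) ∨ HasOneCrossing S ∨ HasPentagonCrossings S ∨
      (HasForkCrossings S ∨ HasHexagonCrossings S) ∨
      closedCount S * 32 < 25 * 2 ^ Nat.card S := by
  by_cases h0 : ∀ x y : S, ¬ Crossing x y
  · exact .inl h0
  push Not at h0
  obtain ⟨a, b, hab⟩ := h0
  by_cases h1 : ∀ x y : S, Crossing x y → s(x, y) = s(a, b)
  · obtain ⟨v, hv⟩ := hab.exists_isLUB
    exact .inr (.inl ⟨a, b, v, hab, hv, h1⟩)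
  push Not at h1
  obtain ⟨c, d, hcd, hne⟩ := h1
  simp only [Ne, Sym2.eq_iff, not_or, not_and] at hne
  rw [or_assoc]
  right
  right
  by_cases hac : a = c
  · subst hac
    exact classify_shared (fun e => hne.1 rfl e.symm) hab.symm hcd.symm
  by_cases had : a = d
  · subst had
    exact classify_shared (fun e => hne.2 e.symm rfl) hab.symm hcd
  by_cases hbc : b = c
  · subst hbc
    exact classify_shared had hab hcd.symm
  by_cases hbd : b = d
  · subst hbd
    exact classify_shared hac hab hcd
  have := closedCount_disjoint hab hcd hac had hbc hbd
  tauto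

/-! ### The tree congruence when all crossing pairs have the same meet -/

/-- The set consisting of `u`, the elements of crossing pairs, and the joins of crossing pairs. -/
def crossBlock (u : S) : Set S :=
  {x | x = u ∨ (∃ y, Crossing x y) ∨ ∃ a b, Crossing a b ∧ IsLUB {a, b} x}

theorem self_mem_crossBlock (u : S) : u ∈ crossBlock u := .inl rfl

theorem le_of_mem_crossBlock {u x : S} (h : ∀ a b : S, Crossing a b → a ⊓ b = u)
    (hx : x ∈ crossBlock u) : u ≤ x := by
  rcases hx with rfl | ⟨y, hxy⟩ | ⟨a, b, hab, hx⟩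
  · exact le_rfl
  · exact h x y hxy ▸ inf_le_left
  · exact h a b hab ▸ inf_le_left.trans (hx.1 (by simp))

/-- Below an element of `crossBlock u`, an element that is in no crossing pair is comparable
with both members of a crossing pair, so it is above their join or below their meet `u`. -/
theorem mem_crossBlock_or_le [Finite S] {u x y : S} (h : ∀ a b : S, Crossing a b → a ⊓ b = u)
    (hx : x ∈ crossBlock u) (hy : y ≤ x) : y ∈ crossBlock u ∨ y ≤ u := by
  have key : ∀ a b v : S, Crossing a b → IsLUB {a, b} v → y ≤ v → y ∈ crossBlock u ∨ y ≤ u := by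
    intro a b v hab hv hyv
    obtain ⟨hav, hbv, hmin⟩ := isLUB_pair_iff.1 hv
    by_cases hya : Crossing y a
    · exact .inl (.inr (.inl ⟨a, hya⟩))
    by_cases hyb : Crossing y b
    · exact .inl (.inr (.inl ⟨b, hyb⟩))
    rcases le_or_le_of_not_crossing hya hyv hav with h1 | h1
    · rcases le_or_le_of_not_crossing hyb hyv hbv with h2 | h2
      · exact .inr (h a b hab ▸ le_inf h1 h2)
      · exact absurd (h2.trans h1) hab.2.1
    · rcases le_or_le_of_not_crossing hyb hyv hbv with h2 | h2
      · exact absurd (h1.trans h2) hab.1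
      · exact .inl (.inr (.inr ⟨a, b, hab, le_antisymm hyv (hmin y h1 h2) ▸ hv⟩))
  rcases hx with rfl | ⟨z, hxz⟩ | ⟨a, b, hab, hx⟩
  · exact .inr hy
  · obtain ⟨v, hv⟩ := hxz.exists_isLUB
    exact key x z v hxz hv (hy.trans (hv.1 (by simp)))
  · exact key a b x hab hx hy

/-- The congruence whose only possibly nonsingleton block is `crossBlock u`. -/
def collapse [Finite S] (u : S) (h : ∀ a b : S, Crossing a b → a ⊓ b = u) : InfCon S where
  r x y := x = y ∨ (x ∈ crossBlock u ∧ y ∈ crossBlock u)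
  iseqv :=
    { refl := fun _ => .inl rfl
      symm := by
        rintro x y (rfl | h)
        · exact .inl rfl
        · exact .inr h.symm
      trans := by
        rintro x y z (rfl | h1) (rfl | h2)
        · exact .inl rfl
        · exact .inr h2
        · exact .inr h1
        · exact .inr ⟨h1.1, h2.2⟩ }
  inf := by
    have key : ∀ x y z : S, x ∈ crossBlock u → y ∈ crossBlock u →
        x ⊓ z = y ⊓ z ∨ (x ⊓ z ∈ crossBlock u ∧ y ⊓ z ∈ crossBlock u) := by
      have ku : ∀ x z : S, x ∈ crossBlock u → ¬ u ≤ z → x ⊓ z = u ⊓ z := by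
        intro x z hx hz
        rcases mem_crossBlock_or_le h hx (inf_le_left : x ⊓ z ≤ x) with h1 | h1
        · exact absurd ((le_of_mem_crossBlock h h1).trans inf_le_right) hz
        · exact le_antisymm (le_inf h1 inf_le_right)
            (inf_le_inf_right z (le_of_mem_crossBlock h hx))
      have kl : ∀ x z : S, x ∈ crossBlock u → u ≤ z → x ⊓ z ∈ crossBlock u := by
        intro x z hx hz
        rcases mem_crossBlock_or_le h hx (inf_le_left : x ⊓ z ≤ x) with h1 | h1
        · exact h1
        · rw [le_antisymm h1 (le_inf (le_of_mem_crossBlock h hx) hz)]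
          exact self_mem_crossBlock u
      intro x y z hx hy
      by_cases hz : u ≤ z
      · exact .inr ⟨kl x z hx hz, kl y z hy hz⟩
      · exact .inl ((ku x z hx hz).trans (ku y z hy hz).symm)
    rintro w x y z (rfl | ⟨h1, h2⟩) (rfl | ⟨h3, h4⟩)
    · exact .inl rfl
    · simpa only [inf_comm w] using key y z w h3 h4
    · exact key w x y h1 h2
    · rcases key w x y h1 h2 with e1 | ⟨e1, e2⟩
      · rw [e1]
        simpa only [inf_comm x] using key y z x h3 h4
      · have e3 := key y z x h3 h4
        simp only [inf_comm _ x] at e3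
        rcases e3 with e3 | ⟨e3, e4⟩
        · rw [← e3]
          exact .inr ⟨e1, e2⟩
        · exact .inr ⟨e1, e4⟩

theorem InfCon.rel_of_le_of_le (c : InfCon S) {x y z : S} (hxy : x ≤ y) (hyz : y ≤ z)
    (h : c.r x z) : c.r y z := by
  have := c.inf (c.iseqv.refl y) h
  rw [inf_eq_right.2 hxy, inf_eq_left.2 hyz] at this
  exact c.iseqv.trans (c.iseqv.symm this) h

theorem treeCon_rel_of_crossing {a b v : S} (hab : Crossing a b) (hv : IsLUB {a, b} v) :
    (treeCon S).r (a ⊓ b) v := fun _ hc => hc a b v hab.1 hab.2.1 hv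

theorem treeCon_rel_iff [Finite S] {u : S} (h : ∀ a b : S, Crossing a b → a ⊓ b = u) (x y : S) :
    (treeCon S).r x y ↔ x = y ∨ (x ∈ crossBlock u ∧ y ∈ crossBlock u) := by
  constructor
  · intro hxy
    refine hxy (collapse u h) fun a b v hab hba hv => .inr ?_
    have hc := crossing_of_isLUB hab hba hv
    rw [h a b hc]
    exact ⟨self_mem_crossBlock u, .inr (.inr ⟨a, b, hc, hv⟩)⟩
  · have key : ∀ x ∈ crossBlock u, (treeCon S).r x u := by
      rintro x (rfl | ⟨y, hxy⟩ | ⟨a, b, hab, hx⟩)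
      · exact (treeCon S).iseqv.refl x
      · obtain ⟨v, hv⟩ := hxy.exists_isLUB
        have h1 := treeCon_rel_of_crossing hxy hv
        have h2 := (treeCon S).rel_of_le_of_le inf_le_left (hv.1 (by simp)) h1
        rw [← h x y hxy]
        exact (treeCon S).iseqv.trans h2 ((treeCon S).iseqv.symm h1)
      · rw [← h a b hab]
        exact (treeCon S).iseqv.symm (treeCon_rel_of_crossing hab hx)
    rintro (rfl | ⟨hx, hy⟩)
    · exact (treeCon S).iseqv.refl x
    · exact (treeCon S).iseqv.trans (key x hx) ((treeCon S).iseqv.symm (key y hy))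

theorem nonsingletonTreeBlocks_eq [Finite S] {u : S} (h : ∀ a b : S, Crossing a b → a ⊓ b = u)
    {a b : S} (hab : Crossing a b) : nonsingletonTreeBlocks S = {crossBlock u} := by
  have hblock : ∀ y ∈ crossBlock u, {x | (treeCon S).toSetoid x y} = crossBlock u := by
    intro y hy
    ext x
    change (treeCon S).r x y ↔ _
    rw [treeCon_rel_iff h]
    constructor
    · rintro (rfl | h)
      · exact hy
      · exact h.1
    · exact fun hx => .inr ⟨hx, hy⟩
  ext B
  constructor
  · rintro ⟨⟨y, rfl⟩, x, hx, z, hz, hxz⟩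
    refine hblock y ?_
    rcases (treeCon_rel_iff h x y).1 hx with rfl | hx
    · rcases (treeCon_rel_iff h z x).1 hz with rfl | hz
      · exact absurd rfl hxz
      · exact hz.2
    · exact hx.2
  · rintro rfl
    exact ⟨⟨u, (hblock u (self_mem_crossBlock u)).symm⟩, a, .inr (.inl ⟨b, hab⟩),
      b, .inr (.inl ⟨a, hab.symm⟩), hab.ne⟩

theorem isQuasiTreeWithNucleus_of_embedding [Finite S] {N : Type*} [SemilatticeInf N] {u : S}
    (h : ∀ a b : S, Crossing a b → a ⊓ b = u) {a b : S} (hab : Crossing a b) (f : N → S)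
    (hinf : ∀ x y, f (x ⊓ y) = f x ⊓ f y) (hf : Function.Injective f)
    (hmem : ∀ x, f x ∈ crossBlock u) (hu : u ∈ Set.range f)
    (hcross : ∀ x y : S, Crossing x y →
      x ∈ Set.range f ∧ ∀ v, IsLUB {x, y} v → v ∈ Set.range f) :
    IsQuasiTreeWithNucleus S N := by
  have hB := nonsingletonTreeBlocks_eq h hab
  refine ⟨⟨crossBlock u, by rw [hB]; rfl, fun C hC => by rwa [hB] at hC⟩, ⟨f, hinf⟩, hf, ?_⟩
  rw [nucleus, hB, Set.sUnion_singleton]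
  refine Set.Subset.antisymm (Set.range_subset_iff.2 hmem) ?_
  rintro x (rfl | ⟨y, hxy⟩ | ⟨a, b, hab, hx⟩)
  · exact hu
  · exact (hcross x y hxy).1
  · exact (hcross a b hab).2 x hx

/-! ### Crossing pairs of a quasi-tree semilattice come from its nucleus -/

theorem crossing_mem_nucleus {x y v : S} (h : Crossing x y) (hv : IsLUB {x, y} v) :
    x ∈ nucleus S ∧ y ∈ nucleus S ∧ v ∈ nucleus S := by
  have h1 := treeCon_rel_of_crossing h hv
  have hx := (treeCon S).rel_of_le_of_le inf_le_left (hv.1 (by simp)) h1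
  have hy := (treeCon S).rel_of_le_of_le inf_le_right (hv.1 (by simp)) h1
  have hB : {z | (treeCon S).toSetoid z v} ∈ nonsingletonTreeBlocks S :=
    ⟨⟨v, rfl⟩, x, hx, y, hy, h.ne⟩
  exact ⟨⟨_, hB, hx⟩, ⟨_, hB, hy⟩, ⟨_, hB, (treeCon S).iseqv.refl v⟩⟩

theorem InfHom.le_iff_of_injective {N : Type*} [SemilatticeInf N] {f : InfHom N S}
    (hf : Function.Injective f) {x y : N} : f x ≤ f y ↔ x ≤ y := by
  rw [← inf_eq_left, ← inf_eq_left, ← map_inf, hf.eq_iff]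

section Embedding

variable {N : Type*} [SemilatticeInf N] {f : InfHom N S}

theorem crossing_map_iff [Finite S] (hf : Function.Injective f) (hr : Set.range f = nucleus S)
    {x y : N} : Crossing (f x) (f y) ↔ Crossing x y := by
  simp only [Crossing, InfHom.le_iff_of_injective hf]
  refine and_congr_right fun h1 => and_congr_right fun h2 => ?_
  constructor
  · rintro ⟨w, hw⟩
    obtain ⟨v, hv⟩ := exists_isLUB_of_le hw.1 hw.2
    have hc : Crossing (f x) (f y) := by
      refine ⟨?_, ?_, w, hw⟩ <;> rwa [InfHom.le_iff_of_injective hf]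
    obtain ⟨v', rfl⟩ : v ∈ Set.range f := hr ▸ (crossing_mem_nucleus hc hv).2.2
    exact ⟨v', (InfHom.le_iff_of_injective hf).1 (hv.1 (by simp)),
      (InfHom.le_iff_of_injective hf).1 (hv.1 (by simp))⟩
  · rintro ⟨v, hv⟩
    exact ⟨f v, (InfHom.le_iff_of_injective hf).2 hv.1, (InfHom.le_iff_of_injective hf).2 hv.2⟩

theorem isLUB_map [Finite S] (hf : Function.Injective f) (hr : Set.range f = nucleus S)
    {x y v : N} (hc : Crossing x y) (hv : x ≤ v ∧ y ≤ v ∧ ∀ w, x ≤ w → y ≤ w → v ≤ w) :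
    IsLUB {f x, f y} (f v) := by
  have hc' := (crossing_map_iff hf hr).2 hc
  obtain ⟨j, hj⟩ := hc'.exists_isLUB
  obtain ⟨j', rfl⟩ : j ∈ Set.range f := hr ▸ (crossing_mem_nucleus hc' hj).2.2
  obtain ⟨hxj, hyj, hmin⟩ := isLUB_pair_iff.1 hj
  rw [InfHom.le_iff_of_injective hf] at hxj hyj
  have h1 := hv.2.2 j' hxj hyj
  have h2 := (InfHom.le_iff_of_injective hf).1 (hmin (f v) ((InfHom.le_iff_of_injective hf).2 hv.1)
    ((InfHom.le_iff_of_injective hf).2 hv.2.1))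
  rwa [le_antisymm h1 h2]

theorem exists_crossing_of_map [Finite S] (hf : Function.Injective f)
    (hr : Set.range f = nucleus S) {x y : S} (hxy : Crossing x y) :
    ∃ x' y', Crossing x' y' ∧ s(x, y) = Sym2.map f s(x', y') := by
  obtain ⟨v, hv⟩ := hxy.exists_isLUB
  obtain ⟨hx, hy, -⟩ := crossing_mem_nucleus hxy hv
  rw [← hr] at hx hy
  obtain ⟨x', rfl⟩ := hx
  obtain ⟨y', rfl⟩ := hy
  exact ⟨x', y', (crossing_map_iff hf hr).1 hxy, by rw [Sym2.map_mk]⟩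

end Embedding

theorem lt_map_of_lt {N : Type*} [SemilatticeInf N] {f : InfHom N S}
    (hf : Function.Injective f) {x y : N} (h : x ≤ y ∧ ¬ y ≤ x) : f x < f y :=
  lt_of_le_not_ge ((InfHom.le_iff_of_injective hf).2 h.1)
    fun h' => h.2 ((InfHom.le_iff_of_injective hf).1 h')

theorem IsQuasiTreeWithNucleus.hasOneCrossing [Finite S]
    (h : IsQuasiTreeWithNucleus S (Bool × Bool)) : HasOneCrossing S := by
  obtain ⟨-, f, hf, hr⟩ := h
  have c1 : Crossing (true, false) (false, true) := by unfold Crossing; decide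
  refine ⟨f (true, false), f (false, true), f (true, true), (crossing_map_iff hf hr).2 c1,
    isLUB_map hf hr c1 (by decide), fun x y hxy => ?_⟩
  obtain ⟨x', y', hc, e⟩ := exists_crossing_of_map hf hr hxy
  have : ∀ x y : Bool × Bool, Crossing x y → s(x, y) = s((true, false), (false, true)) := by
    unfold Crossing
    decide
  rw [e, this x' y' hc, Sym2.map_mk]

theorem IsQuasiTreeWithNucleus.hasPentagonCrossings [Finite S]
    (h : IsQuasiTreeWithNucleus S N5) : HasPentagonCrossings S := by
  obtain ⟨-, f, hf, hr⟩ := h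
  have c1 : Crossing N5.a N5.b := by unfold Crossing; decide
  have c2 : Crossing N5.c N5.b := by unfold Crossing; decide
  refine ⟨f .a, f .b, f .c, f .v, lt_map_of_lt hf (by decide), (crossing_map_iff hf hr).2 c1,
    (crossing_map_iff hf hr).2 c2, isLUB_map hf hr c1 (by decide),
    isLUB_map hf hr c2 (by decide), fun x y hxy => ?_⟩
  obtain ⟨x', y', hc, e⟩ := exists_crossing_of_map hf hr hxy
  have : ∀ x y : N5, Crossing x y → s(x, y) = s(.a, .b) ∨ s(x, y) = s(.c, .b) := by
    unfold Crossing
    decide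
  rw [e]
  exact (this x' y' hc).imp (fun h => by rw [h, Sym2.map_mk]) (fun h => by rw [h, Sym2.map_mk])

theorem IsQuasiTreeWithNucleus.hasForkCrossings [Finite S]
    (h : IsQuasiTreeWithNucleus S F) : HasForkCrossings S := by
  obtain ⟨-, f, hf, hr⟩ := h
  have c1 : Crossing F.a F.b := by unfold Crossing; decide
  have c2 : Crossing F.c F.b := by unfold Crossing; decide
  refine ⟨f .a, f .b, f .c, f .v₁, f .v₂, hf.ne (by decide), (crossing_map_iff hf hr).2 c1,
    (crossing_map_iff hf hr).2 c2, isLUB_map hf hr c1 (by decide),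
    isLUB_map hf hr c2 (by decide), fun x y hxy => ?_⟩
  obtain ⟨x', y', hc, e⟩ := exists_crossing_of_map hf hr hxy
  have : ∀ x y : F, Crossing x y → s(x, y) = s(.a, .b) ∨ s(x, y) = s(.c, .b) := by
    unfold Crossing
    decide
  rw [e]
  exact (this x' y' hc).imp (fun h => by rw [h, Sym2.map_mk]) (fun h => by rw [h, Sym2.map_mk])

theorem IsQuasiTreeWithNucleus.hasHexagonCrossings [Finite S]
    (h : IsQuasiTreeWithNucleus S N6) : HasHexagonCrossings S := by
  obtain ⟨-, f, hf, hr⟩ := h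
  have c1 : Crossing N6.a₁ N6.b := by unfold Crossing; decide
  have c2 : Crossing N6.a₂ N6.b := by unfold Crossing; decide
  have c3 : Crossing N6.a₃ N6.b := by unfold Crossing; decide
  refine ⟨f .a₁, f .a₂, f .a₃, f .b, f .v, lt_map_of_lt hf (by decide),
    lt_map_of_lt hf (by decide), (crossing_map_iff hf hr).2 c1,
    (crossing_map_iff hf hr).2 c2, (crossing_map_iff hf hr).2 c3, isLUB_map hf hr c1 (by decide),
    isLUB_map hf hr c2 (by decide), isLUB_map hf hr c3 (by decide), fun x y hxy => ?_⟩
  obtain ⟨x', y', hc, e⟩ := exists_crossing_of_map hf hr hxy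
  have : ∀ x y : N6, Crossing x y →
      s(x, y) = s(.a₁, .b) ∨ s(x, y) = s(.a₂, .b) ∨ s(x, y) = s(.a₃, .b) := by
    unfold Crossing
    decide
  rw [e]
  exact (this x' y' hc).imp (fun h => by rw [h, Sym2.map_mk])
    (Or.imp (fun h => by rw [h, Sym2.map_mk]) (fun h => by rw [h, Sym2.map_mk]))

/-! ### The nuclei of the extremal configurations -/

theorem Crossing.inf_ne_left {a b : S} (h : Crossing a b) : a ⊓ b ≠ a :=
  fun e => h.1 (inf_eq_left.1 e)

theorem Crossing.inf_ne_right {a b : S} (h : Crossing a b) : a ⊓ b ≠ b :=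
  fun e => h.2.1 (inf_eq_right.1 e)

theorem Crossing.inf_ne_of_isLUB {a b v : S} (h : Crossing a b) (hv : IsLUB {a, b} v) :
    a ⊓ b ≠ v :=
  fun e => h.1 ((hv.1 (by simp) : a ≤ v).trans (e ▸ inf_le_right))

/-- Two members `p ≤ q` of a chain have the same meet with an element `b` that crosses `p`, unless
`q ⊓ b` crosses `p`. -/
theorem Crossing.inf_eq_inf_of_le {p q b : S} (h : Crossing p b) (hpq : p ≤ q)
    (hc : ¬ Crossing (q ⊓ b) p) : q ⊓ b = p ⊓ b := by
  refine le_antisymm (le_inf ?_ inf_le_right) (inf_le_inf_right b hpq)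
  refine (le_or_le_of_not_crossing hc inf_le_left hpq).resolve_right fun h' => ?_
  exact h.1 (h'.trans inf_le_right)

theorem inf_eq_inf_of_sym2_eq {a b x y : S} (h : s(x, y) = s(a, b)) : x ⊓ y = a ⊓ b := by
  rcases Sym2.eq_iff.1 h with ⟨rfl, rfl⟩ | ⟨rfl, rfl⟩
  · rfl
  · exact inf_comm _ _

theorem eq_or_eq_of_sym2_eq {α : Type*} {a b x y : α} (h : s(x, y) = s(a, b)) : x = a ∨ x = b :=
  (Sym2.eq_iff.1 h).imp And.left And.left

theorem IsLUB.eq_of_sym2_eq {a b x y v z : S} (hv : IsLUB {a, b} v) (h : s(x, y) = s(a, b))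
    (hz : IsLUB {x, y} z) : z = v := by
  rcases Sym2.eq_iff.1 h with ⟨rfl, rfl⟩ | ⟨rfl, rfl⟩
  · exact hz.unique hv
  · exact hz.unique (isLUB_pair_comm hv)

theorem HasOneCrossing.isQuasiTreeWithNucleus [Finite S] (h : HasOneCrossing S) :
    IsQuasiTreeWithNucleus S (Bool × Bool) := by
  obtain ⟨a, b, v, hab, hv, hall⟩ := h
  have hav : a ≤ v := hv.1 (by simp)
  have hbv : b ≤ v := hv.1 (by simp)
  have n1 := hab.ne
  have n2 := hab.ne_left hv
  have n3 := hab.ne_right hv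
  have n4 := hab.inf_ne_left
  have n5 := hab.inf_ne_right
  have n6 := hab.inf_ne_of_isLUB hv
  have hmeet : ∀ x y : S, Crossing x y → x ⊓ y = a ⊓ b :=
    fun x y hxy => inf_eq_inf_of_sym2_eq (hall x y hxy)
  obtain ⟨u, hu⟩ : ∃ u, a ⊓ b = u := ⟨_, rfl⟩
  have hba : b ⊓ a = u := inf_comm b a ▸ hu
  have hua : u ≤ a := hu ▸ inf_le_left
  have hub : u ≤ b := hu ▸ inf_le_right
  have huv : u ≤ v := hua.trans hav
  rw [hu] at n4 n5 n6 hmeet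
  let f : Bool × Bool → S
    | (false, false) => u
    | (true, false) => a
    | (false, true) => b
    | (true, true) => v
  refine isQuasiTreeWithNucleus_of_embedding hmeet hab f ?_ ?_ ?_ ⟨(false, false), rfl⟩ ?_
  · rintro ⟨_ | _, _ | _⟩ ⟨_ | _, _ | _⟩ <;> simp [f, *]
  · rintro ⟨_ | _, _ | _⟩ ⟨_ | _, _ | _⟩ e <;>
      simp [f, n1, n1.symm, n2, n2.symm, n3, n3.symm, n4, n4.symm, n5, n5.symm, n6, n6.symm] at e ⊢
  · rintro ⟨_ | _, _ | _⟩
    · exact .inl rfl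
    · exact .inr (.inl ⟨a, hab.symm⟩)
    · exact .inr (.inl ⟨b, hab⟩)
    · exact .inr (.inr ⟨a, b, hab, hv⟩)
  · intro x y hxy
    have e := hall x y hxy
    refine ⟨?_, fun z hz => ⟨(true, true), (IsLUB.eq_of_sym2_eq hv e hz).symm⟩⟩
    rcases eq_or_eq_of_sym2_eq e with rfl | rfl
    · exact ⟨(true, false), rfl⟩
    · exact ⟨(false, true), rfl⟩

theorem N5.le_iff {x y : N5} :
    x ≤ y ↔ x = .u ∨ x = y ∨ y = .v ∨ (x = .a ∧ y = .c) := Iff.rfl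

theorem N5.inf_def (x y : N5) : x ⊓ y = if x ≤ y then x else if y ≤ x then y else .u := rfl

theorem N6.le_iff {x y : N6} : x ≤ y ↔ x = .u ∨ x = y ∨ y = .v ∨ (x = .a₁ ∧ y = .a₂) ∨
    (x = .a₁ ∧ y = .a₃) ∨ (x = .a₂ ∧ y = .a₃) := Iff.rfl

theorem N6.inf_def (x y : N6) : x ⊓ y = if x ≤ y then x else if y ≤ x then y else .u := rfl

theorem F.le_iff {x y : F} : x ≤ y ↔ x = .u ∨ x = y ∨ (x = .a ∧ y = .v₁) ∨ (x = .b ∧ y = .v₁) ∨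
    (x = .b ∧ y = .v₂) ∨ (x = .c ∧ y = .v₂) := Iff.rfl

theorem F.inf_def (x y : F) : x ⊓ y =
    if x ≤ y then x else if y ≤ x then y
    else if (x = .v₁ ∧ y = .v₂) ∨ (x = .v₂ ∧ y = .v₁) then .b else .u := rfl

theorem HasPentagonCrossings.isQuasiTreeWithNucleus [Finite S] (h : HasPentagonCrossings S) :
    IsQuasiTreeWithNucleus S N5 := by
  obtain ⟨a, b, c, v, hac, hab, hcb, hv, hv', hall⟩ := h
  have hav : a ≤ v := hv.1 (by simp)
  have hbv : b ≤ v := hv.1 (by simp)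
  have hcv : c ≤ v := hv'.1 (by simp)
  have n1 := hab.ne
  have n2 := hab.ne_left hv
  have n3 := hab.ne_right hv
  have n4 := hab.inf_ne_left
  have n5 := hab.inf_ne_right
  have n6 := hab.inf_ne_of_isLUB hv
  have n7 := hcb.ne
  have n8 := hcb.ne_left hv'
  have n9 := hcb.inf_ne_left
  have n10 := hac.ne
  have hcb_inf : c ⊓ b = a ⊓ b := by
    refine hab.inf_eq_inf_of_le hac.le fun hc => ?_
    rcases (hall _ _ hc).imp eq_or_eq_of_sym2_eq eq_or_eq_of_sym2_eq with (e | e) | (e | e)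
    · exact hab.1 (e ▸ inf_le_right)
    · exact hcb.inf_ne_right e
    · exact n9 e
    · exact hcb.inf_ne_right e
  have hmeet : ∀ x y : S, Crossing x y → x ⊓ y = a ⊓ b := by
    intro x y hxy
    rcases hall x y hxy with e | e
    · exact inf_eq_inf_of_sym2_eq e
    · rw [← hcb_inf]
      exact inf_eq_inf_of_sym2_eq e
  rw [hcb_inf] at n9
  obtain ⟨u, hu⟩ : ∃ u, a ⊓ b = u := ⟨_, rfl⟩
  have hac' := hac.le
  have hba : b ⊓ a = u := inf_comm b a ▸ hu
  have hbc : b ⊓ c = u := by rw [inf_comm b c, hcb_inf, hu]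
  have hua : u ≤ a := hu ▸ inf_le_left
  have hub : u ≤ b := hu ▸ inf_le_right
  have huc : u ≤ c := hua.trans hac.le
  have huv : u ≤ v := hua.trans hav
  rw [hu] at n4 n5 n6 n9 hmeet hcb_inf
  let f : N5 → S
    | .u => u
    | .a => a
    | .b => b
    | .c => c
    | .v => v
  refine isQuasiTreeWithNucleus_of_embedding hmeet hab f ?_ ?_ ?_ ⟨.u, rfl⟩ ?_
  · rintro (_ | _ | _ | _ | _) (_ | _ | _ | _ | _) <;> simp [N5.inf_def, N5.le_iff, f, *]
  · rintro (_ | _ | _ | _ | _) (_ | _ | _ | _ | _) e <;>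
      simp [f, n1, n1.symm, n2, n2.symm, n3, n3.symm, n4, n4.symm, n5, n5.symm, n6, n6.symm,
        n7, n7.symm, n8, n8.symm, n9, n9.symm, n10, n10.symm] at e ⊢
  · rintro (_ | _ | _ | _ | _)
    · exact .inl rfl
    · exact .inr (.inl ⟨b, hab⟩)
    · exact .inr (.inl ⟨a, hab.symm⟩)
    · exact .inr (.inl ⟨b, hcb⟩)
    · exact .inr (.inr ⟨a, b, hab, hv⟩)
  · intro x y hxy
    rcases hall x y hxy with e | e
    · refine ⟨?_, fun z hz => ⟨.v, (IsLUB.eq_of_sym2_eq hv e hz).symm⟩⟩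
      rcases eq_or_eq_of_sym2_eq e with rfl | rfl
      · exact ⟨.a, rfl⟩
      · exact ⟨.b, rfl⟩
    · refine ⟨?_, fun z hz => ⟨.v, (IsLUB.eq_of_sym2_eq hv' e hz).symm⟩⟩
      rcases eq_or_eq_of_sym2_eq e with rfl | rfl
      · exact ⟨.c, rfl⟩
      · exact ⟨.b, rfl⟩

theorem HasHexagonCrossings.isQuasiTreeWithNucleus [Finite S] (h : HasHexagonCrossings S) :
    IsQuasiTreeWithNucleus S N6 := by
  obtain ⟨a₁, a₂, a₃, b, v, h12, h23, h1, h2, h3, hv1, hv2, hv3, hall⟩ := h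
  have l1 : a₁ ≤ v := hv1.1 (by simp)
  have l2 : a₂ ≤ v := hv2.1 (by simp)
  have l3 : a₃ ≤ v := hv3.1 (by simp)
  have lb : b ≤ v := hv1.1 (by simp)
  have h13 := h12.trans h23
  have not_crossing : ∀ q p : S, Crossing q b → p ≠ b → ¬ Crossing (q ⊓ b) p := by
    intro q p hq hp hc
    have hne := hq.inf_ne_right
    have := hall _ _ hc
    simp only [Sym2.eq_iff] at this
    tauto
  have m2 : a₂ ⊓ b = a₁ ⊓ b := h1.inf_eq_inf_of_le h12.le (not_crossing _ _ h2 h1.ne)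
  have m3 : a₃ ⊓ b = a₁ ⊓ b := h1.inf_eq_inf_of_le h13.le (not_crossing _ _ h3 h1.ne)
  have hmeet : ∀ x y : S, Crossing x y → x ⊓ y = a₁ ⊓ b := by
    intro x y hxy
    rcases hall x y hxy with e | e | e
    · exact inf_eq_inf_of_sym2_eq e
    · rw [← m2]
      exact inf_eq_inf_of_sym2_eq e
    · rw [← m3]
      exact inf_eq_inf_of_sym2_eq e
  have n1 := h1.ne
  have n2 := h2.ne
  have n3 := h3.ne
  have n4 := h1.ne_left hv1
  have n5 := h2.ne_left hv2
  have n6 := h3.ne_left hv3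
  have n7 := h1.ne_right hv1
  have n8 := h1.inf_ne_left
  have n9 := h2.inf_ne_left
  have n10 := h3.inf_ne_left
  have n11 := h1.inf_ne_right
  have n12 := h1.inf_ne_of_isLUB hv1
  have n13 := h12.ne
  have n14 := h23.ne
  have n15 := h13.ne
  rw [m2] at n9
  rw [m3] at n10
  obtain ⟨u, hu⟩ : ∃ u, a₁ ⊓ b = u := ⟨_, rfl⟩
  have l12 := h12.le
  have l23 := h23.le
  have l13 := h13.le
  have hb1 : b ⊓ a₁ = u := by rw [inf_comm, hu]
  have hb2 : b ⊓ a₂ = u := by rw [inf_comm, m2, hu]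
  have hb3 : b ⊓ a₃ = u := by rw [inf_comm, m3, hu]
  have u1 : u ≤ a₁ := hu ▸ inf_le_left
  have u2 : u ≤ a₂ := u1.trans l12
  have u3 : u ≤ a₃ := u1.trans l13
  have ub : u ≤ b := hu ▸ inf_le_right
  have uv : u ≤ v := ub.trans lb
  rw [hu] at n8 n9 n10 n11 n12 hmeet m2 m3
  let f : N6 → S
    | .u => u
    | .a₁ => a₁
    | .a₂ => a₂
    | .a₃ => a₃
    | .b => b
    | .v => v
  refine isQuasiTreeWithNucleus_of_embedding hmeet h1 f ?_ ?_ ?_ ⟨.u, rfl⟩ ?_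
  · rintro (_ | _ | _ | _ | _ | _) (_ | _ | _ | _ | _ | _) <;>
      simp [N6.inf_def, N6.le_iff, f, hu, m2, m3, hb1, hb2, hb3, u1, u2, u3, ub, uv, l1, l2, l3,
        lb, l12, l23, l13]
  · rintro (_ | _ | _ | _ | _ | _) (_ | _ | _ | _ | _ | _) e <;>
      simp [f, n1, n1.symm, n2, n2.symm, n3, n3.symm, n4, n4.symm, n5, n5.symm, n6, n6.symm,
        n7, n7.symm, n8, n8.symm, n9, n9.symm, n10, n10.symm, n11, n11.symm, n12, n12.symm,
        n13, n13.symm, n14, n14.symm, n15, n15.symm] at e ⊢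
  · rintro (_ | _ | _ | _ | _ | _)
    · exact .inl rfl
    · exact .inr (.inl ⟨b, h1⟩)
    · exact .inr (.inl ⟨b, h2⟩)
    · exact .inr (.inl ⟨b, h3⟩)
    · exact .inr (.inl ⟨a₁, h1.symm⟩)
    · exact .inr (.inr ⟨a₁, b, h1, hv1⟩)
  · intro x y hxy
    rcases hall x y hxy with e | e | e
    · refine ⟨?_, fun z hz => ⟨.v, (IsLUB.eq_of_sym2_eq hv1 e hz).symm⟩⟩
      rcases eq_or_eq_of_sym2_eq e with rfl | rfl
      · exact ⟨.a₁, rfl⟩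
      · exact ⟨.b, rfl⟩
    · refine ⟨?_, fun z hz => ⟨.v, (IsLUB.eq_of_sym2_eq hv2 e hz).symm⟩⟩
      rcases eq_or_eq_of_sym2_eq e with rfl | rfl
      · exact ⟨.a₂, rfl⟩
      · exact ⟨.b, rfl⟩
    · refine ⟨?_, fun z hz => ⟨.v, (IsLUB.eq_of_sym2_eq hv3 e hz).symm⟩⟩
      rcases eq_or_eq_of_sym2_eq e with rfl | rfl
      · exact ⟨.a₃, rfl⟩
      · exact ⟨.b, rfl⟩

/-- The meets in the fork configuration. All of them follow from the fact that bounded elements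
other than `b` are comparable; in particular `v ⊓ w` must be `b`, since otherwise it would be
comparable with `a`. -/
theorem fork_inf_eq {a b c v w : S} (hvw : v ≠ w) (hab : Crossing a b)
    (hcb : Crossing c b) (hv : IsLUB {a, b} v) (hw : IsLUB {c, b} w)
    (hall : ∀ x y : S, Crossing x y → s(x, y) = s(a, b) ∨ s(x, y) = s(c, b)) :
    v ⊓ w = b ∧ c ⊓ b = a ⊓ b ∧ a ⊓ w = a ⊓ b ∧ c ⊓ v = a ⊓ b ∧ a ⊓ c = a ⊓ b := by
  obtain ⟨hav, hbv, hvmin⟩ := isLUB_pair_iff.1 hv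
  obtain ⟨hcw, hbw, hwmin⟩ := isLUB_pair_iff.1 hw
  -- Two bounded elements, neither of which is `b`, are comparable.
  have cmp : ∀ x y z : S, x ≠ b → y ≠ b → x ≤ z → y ≤ z → x ≤ y ∨ y ≤ x := by
    intro x y z hx hy hxz hyz
    refine le_or_le_of_not_crossing (fun hc => ?_) hxz hyz
    have := hall x y hc
    simp only [Sym2.eq_iff] at this
    tauto
  have hnvw : ¬ v ≤ w := by
    intro h
    rcases cmp a c w hab.ne hcb.ne (hav.trans h) hcw with h1 | h1
    · rcases cmp v c w (hab.ne_right hv) hcb.ne h hcw with h2 | h2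
      · exact hcb.2.1 (hbv.trans h2)
      · exact hvw (le_antisymm h (hwmin v h2 hbv))
    · exact hvw (le_antisymm h (hwmin v (h1.trans hav) hbv))
  have hnwv : ¬ w ≤ v := by
    intro h
    rcases cmp c a v hcb.ne hab.ne (hcw.trans h) hav with h1 | h1
    · rcases cmp w a v (hcb.ne_right hw) hab.ne h hav with h2 | h2
      · exact hab.2.1 (hbw.trans h2)
      · exact hvw (le_antisymm (hvmin w h2 hbw) h)
    · exact hvw (le_antisymm (hvmin w (h1.trans hcw) hbw) h)
  have haw : ¬ a ≤ w := fun h => hnvw (hvmin w h hbw)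
  have hcv : ¬ c ≤ v := fun h => hnwv (hwmin v h hbv)
  have e1 : v ⊓ w = b := by
    by_contra hne
    rcases cmp (v ⊓ w) a v hne hab.ne inf_le_left hav with h1 | h1
    · exact hab.2.1 ((le_inf hbv hbw).trans h1)
    · exact haw (h1.trans inf_le_right)
  have e2 : a ⊓ w = a ⊓ b := by
    refine le_antisymm (le_inf inf_le_left ?_) (inf_le_inf_left a hbw)
    exact (le_inf (inf_le_left.trans hav) inf_le_right).trans e1.le
  have e3 : c ⊓ v = c ⊓ b := by
    refine le_antisymm (le_inf inf_le_left ?_) (inf_le_inf_left c hbv)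
    exact (le_inf inf_le_right (inf_le_left.trans hcw)).trans e1.le
  have e4 : c ⊓ b = a ⊓ b := by
    apply le_antisymm
    · refine le_inf ?_ inf_le_right
      exact (cmp (c ⊓ b) a v hcb.inf_ne_right hab.ne (inf_le_right.trans hbv) hav).resolve_right
        fun h => hab.1 (h.trans inf_le_right)
    · refine le_inf ?_ inf_le_right
      exact (cmp (a ⊓ b) c w hab.inf_ne_right hcb.ne (inf_le_right.trans hbw) hcw).resolve_right
        fun h => hcb.1 (h.trans inf_le_right)
  refine ⟨e1, e4, e2, e3.trans e4, le_antisymm ?_ (le_inf inf_le_left (e4 ▸ inf_le_left))⟩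
  exact (inf_le_inf_left a hcw).trans e2.le

theorem HasForkCrossings.isQuasiTreeWithNucleus [Finite S] (h : HasForkCrossings S) :
    IsQuasiTreeWithNucleus S F := by
  obtain ⟨a, b, c, v, w, hvw, hab, hcb, hv, hw, hall⟩ := h
  obtain ⟨m1, m2, m3, m4, m5⟩ := fork_inf_eq hvw hab hcb hv hw hall
  have hav : a ≤ v := hv.1 (by simp)
  have hbv : b ≤ v := hv.1 (by simp)
  have hcw : c ≤ w := hw.1 (by simp)
  have hbw : b ≤ w := hw.1 (by simp)
  have hmeet : ∀ x y : S, Crossing x y → x ⊓ y = a ⊓ b := by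
    intro x y hxy
    rcases hall x y hxy with e | e
    · exact inf_eq_inf_of_sym2_eq e
    · rw [← m2]
      exact inf_eq_inf_of_sym2_eq e
  have n1 := hab.ne
  have n2 := hab.ne_left hv
  have n3 := hab.ne_right hv
  have n4 := hab.inf_ne_left
  have n5 := hab.inf_ne_right
  have n6 := hab.inf_ne_of_isLUB hv
  have n7 := hcb.ne
  have n8 := hcb.ne_left hw
  have n9 := hcb.ne_right hw
  have n10 := hcb.inf_ne_left
  have n11 := hcb.inf_ne_of_isLUB hw
  have n12 : a ≠ c := by
    rintro rfl
    exact hvw (hv.unique hw)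
  have n13 : v ≠ c := by
    rintro rfl
    exact hcb.2.1 hbv
  have n14 : w ≠ a := by
    rintro rfl
    exact hab.2.1 hbw
  rw [m2] at n10 n11
  obtain ⟨u, hu⟩ : ∃ u, a ⊓ b = u := ⟨_, rfl⟩
  rw [hu] at n4 n5 n6 n10 n11 hmeet m2 m3 m4 m5
  have m0' : b ⊓ a = u := by rw [inf_comm, hu]
  have m1' : w ⊓ v = b := by rw [inf_comm, m1]
  have m2' : b ⊓ c = u := by rw [inf_comm, m2]
  have m3' : w ⊓ a = u := by rw [inf_comm, m3]
  have m4' : v ⊓ c = u := by rw [inf_comm, m4]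
  have m5' : c ⊓ a = u := by rw [inf_comm, m5]
  have ua : u ≤ a := hu ▸ inf_le_left
  have ub : u ≤ b := hu ▸ inf_le_right
  have uc : u ≤ c := m2 ▸ inf_le_left
  have uv : u ≤ v := ua.trans hav
  have uw : u ≤ w := uc.trans hcw
  let f : F → S
    | .u => u
    | .a => a
    | .b => b
    | .c => c
    | .v₁ => v
    | .v₂ => w
  refine isQuasiTreeWithNucleus_of_embedding hmeet hab f ?_ ?_ ?_ ⟨.u, rfl⟩ ?_
  · rintro (_ | _ | _ | _ | _ | _) (_ | _ | _ | _ | _ | _) <;>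
      simp [F.inf_def, F.le_iff, f, hu, m1, m2, m3, m4, m5, m0', m1', m2', m3', m4', m5', ua, ub,
        uc, uv, uw, hav, hbv, hcw, hbw]
  · rintro (_ | _ | _ | _ | _ | _) (_ | _ | _ | _ | _ | _) e <;>
      simp [f, n1, n1.symm, n2, n2.symm, n3, n3.symm, n4, n4.symm, n5, n5.symm, n6, n6.symm,
        n7, n7.symm, n8, n8.symm, n9, n9.symm, n10, n10.symm, n11, n11.symm, n12, n12.symm,
        n13, n13.symm, n14, n14.symm, hvw, hvw.symm] at e ⊢
  · rintro (_ | _ | _ | _ | _ | _)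
    · exact .inl rfl
    · exact .inr (.inl ⟨b, hab⟩)
    · exact .inr (.inl ⟨a, hab.symm⟩)
    · exact .inr (.inl ⟨b, hcb⟩)
    · exact .inr (.inr ⟨a, b, hab, hv⟩)
    · exact .inr (.inr ⟨c, b, hcb, hw⟩)
  · intro x y hxy
    rcases hall x y hxy with e | e
    · refine ⟨?_, fun z hz => ⟨.v₁, (IsLUB.eq_of_sym2_eq hv e hz).symm⟩⟩
      rcases eq_or_eq_of_sym2_eq e with rfl | rfl
      · exact ⟨.a, rfl⟩
      · exact ⟨.b, rfl⟩
    · refine ⟨?_, fun z hz => ⟨.v₂, (IsLUB.eq_of_sym2_eq hw e hz).symm⟩⟩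
      rcases eq_or_eq_of_sym2_eq e with rfl | rfl
      · exact ⟨.c, rfl⟩
      · exact ⟨.b, rfl⟩

/-! ### The largest numbers of congruences -/

theorem isTree_iff : IsTree S ↔ ∀ x y : S, ¬ Crossing x y :=
  ⟨fun h x y hxy => h x y hxy.1 hxy.2.1 hxy.2.2, fun h a b hab hba hv => h a b ⟨hab, hba, hv⟩⟩

/-- The density classes of the join-closed sets, with the structure that characterizes the four
largest ones. -/
theorem closedCount_classes (S : Type*) [SemilatticeInf S] [Finite S] :
    (IsTree S → closedCount S * 32 = 32 * 2 ^ Nat.card S) ∧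
    (IsQuasiTreeWithNucleus S (Bool × Bool) → closedCount S * 32 = 28 * 2 ^ Nat.card S) ∧
    (IsQuasiTreeWithNucleus S N5 → closedCount S * 32 = 26 * 2 ^ Nat.card S) ∧
    (IsQuasiTreeWithNucleus S F ∨ IsQuasiTreeWithNucleus S N6 →
      closedCount S * 32 = 25 * 2 ^ Nat.card S) ∧
    (IsTree S ∨ IsQuasiTreeWithNucleus S (Bool × Bool) ∨ IsQuasiTreeWithNucleus S N5 ∨
      (IsQuasiTreeWithNucleus S F ∨ IsQuasiTreeWithNucleus S N6) ∨
      closedCount S * 32 < 25 * 2 ^ Nat.card S) :=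
  ⟨fun h => by rw [closedCount_of_no_crossing (isTree_iff.1 h), mul_comm],
    fun h => h.hasOneCrossing.closedCount,
    fun h => h.hasPentagonCrossings.closedCount,
    fun h => h.elim (fun h => h.hasForkCrossings.closedCount)
      fun h => h.hasHexagonCrossings.closedCount,
    (classify_crossings S).imp isTree_iff.2 <|
      Or.imp HasOneCrossing.isQuasiTreeWithNucleus <|
      Or.imp HasPentagonCrossings.isQuasiTreeWithNucleus <|
      Or.imp_left <| Or.imp HasForkCrossings.isQuasiTreeWithNucleus
        HasHexagonCrossings.isQuasiTreeWithNucleus⟩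

end FiniteSemilattice

theorem theorem2p3 {S : Type*} [SemilatticeInf S] [Finite S] (n : ℕ)
    (hS : Nat.card S = n) (hn : 1 < n) :
    -- (a)
    ((2 : ℚ) ^ (n - 1) = 32 * (2 : ℚ) ^ ((n : ℤ) - 6) ∧
      Nat.card (FiniteSemilattice.InfCon S) ≤ 2 ^ (n - 1) ∧
      (Nat.card (FiniteSemilattice.InfCon S) = 2 ^ (n - 1) ↔ FiniteSemilattice.IsTree S)) ∧
    -- (b)
    ((Nat.card (FiniteSemilattice.InfCon S) < 2 ^ (n - 1) →
        (Nat.card (FiniteSemilattice.InfCon S) : ℚ) ≤ 28 * (2 : ℚ) ^ ((n : ℤ) - 6)) ∧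
      ((Nat.card (FiniteSemilattice.InfCon S) : ℚ) = 28 * (2 : ℚ) ^ ((n : ℤ) - 6) ↔
        FiniteSemilattice.IsQuasiTreeWithNucleus S (Bool × Bool))) ∧
    -- (c)
    (((Nat.card (FiniteSemilattice.InfCon S) : ℚ) < 28 * (2 : ℚ) ^ ((n : ℤ) - 6) →
        (Nat.card (FiniteSemilattice.InfCon S) : ℚ) ≤ 26 * (2 : ℚ) ^ ((n : ℤ) - 6)) ∧
      ((Nat.card (FiniteSemilattice.InfCon S) : ℚ) = 26 * (2 : ℚ) ^ ((n : ℤ) - 6) ↔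
        FiniteSemilattice.IsQuasiTreeWithNucleus S FiniteSemilattice.N5)) ∧
    -- (d)
    (((Nat.card (FiniteSemilattice.InfCon S) : ℚ) < 26 * (2 : ℚ) ^ ((n : ℤ) - 6) →
        (Nat.card (FiniteSemilattice.InfCon S) : ℚ) ≤ 25 * (2 : ℚ) ^ ((n : ℤ) - 6)) ∧
      ((Nat.card (FiniteSemilattice.InfCon S) : ℚ) = 25 * (2 : ℚ) ^ ((n : ℤ) - 6) ↔
        (FiniteSemilattice.IsQuasiTreeWithNucleus S FiniteSemilattice.F ∨
          FiniteSemilattice.IsQuasiTreeWithNucleus S FiniteSemilattice.N6))) := by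
  have : Nonempty S := (Nat.card_pos_iff.1 (by lia : 0 < Nat.card S)).1
  obtain ⟨h1, h2, h3, h4, h5⟩ := FiniteSemilattice.closedCount_classes S
  rw [FiniteSemilattice.closedCount_eq_two_mul, hS] at h1 h2 h3 h4 h5
  -- In terms of `t = 2 ^ (n - 1)`, each bound `k * 2 ^ (n - 6)` is `k * t / 32`.
  obtain ⟨m, rfl⟩ : ∃ m, n = m + 1 := ⟨n - 1, by lia⟩
  have hpow : (2 : ℚ) ^ (((m + 1 : ℕ) : ℤ) - 6) = ((2 ^ m : ℕ) : ℚ) / 32 := by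
    rw [show (((m + 1 : ℕ) : ℤ) - 6) = (m : ℤ) - 5 by push_cast; ring,
      zpow_sub₀ (by norm_num), zpow_natCast]
    norm_num
  have hpow' : (2 : ℚ) ^ m = ((2 ^ m : ℕ) : ℚ) := by norm_num
  have htpos : 0 < 2 ^ m := by positivity
  rw [hpow, Nat.add_sub_cancel, hpow']
  rw [pow_succ] at h1 h2 h3 h4 h5
  generalize 2 ^ m = t at *
  generalize Nat.card (FiniteSemilattice.InfCon S) = C at *
  have hle : ∀ k : ℕ, (C : ℚ) ≤ k * ((t : ℚ) / 32) ↔ 32 * C ≤ k * t := fun k => by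
    rw [← mul_div_assoc, le_div_iff₀ (by norm_num), mul_comm]
    exact_mod_cast Iff.rfl
  have hlt : ∀ k : ℕ, (C : ℚ) < k * ((t : ℚ) / 32) ↔ 32 * C < k * t := fun k => by
    rw [← mul_div_assoc, lt_div_iff₀ (by norm_num), mul_comm]
    exact_mod_cast Iff.rfl
  have heq : ∀ k : ℕ, (C : ℚ) = k * ((t : ℚ) / 32) ↔ 32 * C = k * t := fun k => by
    rw [← mul_div_assoc, eq_div_iff (by norm_num), mul_comm]
    exact_mod_cast Iff.rfl
  have q28 := And.intro (hle 28) (And.intro (hlt 28) (heq 28))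
  have q26 := And.intro (hle 26) (And.intro (hlt 26) (heq 26))
  have q25 := And.intro (hle 25) (And.intro (hlt 25) (heq 25))
  push_cast at q28 q26 q25
  rw [q28.1, q28.2.1, q28.2.2, q26.1, q26.2.1, q26.2.2, q25.1, q25.2.2]
  refine ⟨⟨by ring, ?_, ?_⟩, ⟨?_, ?_⟩, ⟨?_, ?_⟩, ⟨?_, ?_⟩⟩
  all_goals
    rcases h5 with h | h | h | h | h
    · have := h1 h
      grind
    · have := h2 h
      grind
    · have := h3 h
      grind
    · have := h4 h
      grind
    · grind
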